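/- Let $(\Omega,\mathcal F,(\mathcal F_t)_{t\ge 0},\mathbb P)$ be a filtered probability space carrying a $k$-dimensional $(\mathcal F_t)$-Brownian motion $B$. Let $b:\mathbb R^d\to\mathbb R^d$ and $\sigma:\mathbb R^d\to\mathbb R^{d\times k}$ be locally Lipschitz with $\sigma\sigma^*$ bounded (and possibly degenerate). For each $x\in\mathbb R^d$ let $X=X^x$ be a continuous adapted process, defined for all $t\ge 0$, which solves the Itô equation $$dX_t=b(X_t)\,dt+\sigma(X_t)\,dB_t,\qquad X_0=x,$$ and write $\mathbb E_x$ for expectations of functionals of $X^x$. Suppose that for every $R>0$ there exist a continuous function $f:\mathbb R^d\to[0,1]$ with $\operatorname{supp}(f)\subset\{y:|y|\ge R+1\}$ and a time $t_0\ge 0$ such that $$\inf_{|x|\le R}\mathbb E_x f(X_{t_0})>0 .$$ Then the following condition $(A_T)$ holds: for every $R>0$, $$\sup_{|x|\le R}\mathbb E_x\inf\{t\ge 0:|X_t|\ge R+1\}<\infty ,$$ where $\inf\emptyset=+\infty$. -/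

import Mathlib

open MeasureTheory ProbabilityTheory Filter Topology
open scoped NNReal ENNReal

/-- `B` is a standard `k`-dimensional Brownian motion with respect to the filtration `F`. -/
structure IsBrownianMotion {Ω : Type*} [mΩ : MeasurableSpace Ω] {k : ℕ}
    (P : Measure Ω) (F : Filtration ℝ≥0 mΩ)
    (B : ℝ≥0 → Ω → EuclideanSpace ℝ (Fin k)) : Prop where
  adapted : Adapted F B
  continuous_paths : ∀ ω, Continuous fun t => B t ω
  start_zero : ∀ᵐ ω ∂P, B 0 ω = 0
  increment_law : ∀ s t : ℝ≥0, s ≤ t →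
    P.map (fun ω => B t ω - B s ω) =
      (stdGaussian (EuclideanSpace ℝ (Fin k))).map (fun z => Real.sqrt ((t : ℝ) - s) • z)
  increment_indep : ∀ s t : ℝ≥0, s ≤ t →
    Indep (MeasurableSpace.comap (fun ω => B t ω - B s ω) inferInstance) (F s) P

/-- `π 0 ≤ π 1 ≤ ⋯ ≤ π N` is a subdivision of the interval `[0, t]`. -/
structure IsSubdivision (t : ℝ≥0) (N : ℕ) (π : ℕ → ℝ≥0) : Prop where
  mono : Monotone π
  left : π 0 = 0
  right : π N = t

/-- `I` is the Itô integral process `I t = ∫₀ᵗ H dB` of a continuous adapted operator-valued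
integrand `H`: for every `t`, the left-point Riemann sums along any sequence of subdivisions of
`[0, t]` whose mesh tends to `0` converge in probability to `I t`. -/
def IsItoIntegral {Ω : Type*} [MeasurableSpace Ω] {k d : ℕ} (P : Measure Ω)
    (B : ℝ≥0 → Ω → EuclideanSpace ℝ (Fin k))
    (H : ℝ≥0 → Ω → (EuclideanSpace ℝ (Fin k) →L[ℝ] EuclideanSpace ℝ (Fin d)))
    (I : ℝ≥0 → Ω → EuclideanSpace ℝ (Fin d)) : Prop :=
  ∀ (t : ℝ≥0) (N : ℕ → ℕ) (π : ℕ → ℕ → ℝ≥0),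
    (∀ n, IsSubdivision t (N n) (π n)) →
    (∀ ε : ℝ, 0 < ε → ∀ᶠ n in atTop, ∀ i < N n, (π n (i + 1) : ℝ) - π n i < ε) →
    TendstoInMeasure P
      (fun n ω => ∑ i ∈ Finset.range (N n),
        H (π n i) ω (B (π n (i + 1)) ω - B (π n i) ω))
      atTop (I t)

/-- `X` is a (continuous, adapted, defined for all times) solution of the Itô equation
`dX_t = b(X_t) dt + σ(X_t) dB_t`, `X_0 = x`. -/
structure IsSDESolution {Ω : Type*} [mΩ : MeasurableSpace Ω] {k d : ℕ}
    (P : Measure Ω) (F : Filtration ℝ≥0 mΩ)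
    (B : ℝ≥0 → Ω → EuclideanSpace ℝ (Fin k))
    (b : EuclideanSpace ℝ (Fin d) → EuclideanSpace ℝ (Fin d))
    (σ : EuclideanSpace ℝ (Fin d) →
      (EuclideanSpace ℝ (Fin k) →L[ℝ] EuclideanSpace ℝ (Fin d)))
    (x : EuclideanSpace ℝ (Fin d))
    (X : ℝ≥0 → Ω → EuclideanSpace ℝ (Fin d)) : Prop where
  adapted : Adapted F X
  continuous_paths : ∀ ω, Continuous fun t => X t ω
  equation : ∃ I : ℝ≥0 → Ω → EuclideanSpace ℝ (Fin d),
    IsItoIntegral P B (fun t ω => σ (X t ω)) I ∧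
    ∀ t : ℝ≥0, ∀ᵐ ω ∂P,
      X t ω = x + (∫ s in (0 : ℝ)..t, b (X s.toNNReal ω)) + I t ω

/-- The time `inf {t ≥ 0 : |X_t| ≥ r}`, with value `∞` if `|X_t| < r` for all `t`. -/
noncomputable def exitTime {Ω : Type*} {d : ℕ}
    (X : ℝ≥0 → Ω → EuclideanSpace ℝ (Fin d)) (r : ℝ) (ω : Ω) : ℝ≥0∞ :=
  ⨅ (t : ℝ≥0) (_ : r ≤ ‖X t ω‖), (t : ℝ≥0∞)

/-- Condition `(A_T)` for the family `X x`, `x ∈ ℝᵈ`, where `X x` is the process started at `x`: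
for every `R > 0`, `sup_{|x| ≤ R} E_x inf {t ≥ 0 : |X_t| ≥ R + 1} < ∞`. -/
def ConditionAT {Ω : Type*} [MeasurableSpace Ω] {d : ℕ} (P : Measure Ω)
    (X : EuclideanSpace ℝ (Fin d) → ℝ≥0 → Ω → EuclideanSpace ℝ (Fin d)) : Prop :=
  ∀ R : ℝ, 0 < R →
    (⨆ (x : EuclideanSpace ℝ (Fin d)) (_ : ‖x‖ ≤ R),
      ∫⁻ ω, exitTime (X x) (R + 1) ω ∂P) < ∞

/-! Put `ρ = R + 1`. The hypothesis at radius `ρ` yields `t₀` and `ε > 0` such that from every point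
of the closed `ρ`-ball the expectation of `ramp ρ` at time `t₀` is at least `ε`. If `A n` is the
event of lying in this ball at times `0, t₀, …, n * t₀`, the Markov property gives `ε P(A n) ≤ P(A
n) - P(A (n+1))`. Telescoping gives `ε ∑ P(A n) ≤ 1`, and the exit time is at most `t₀ ∑ 1_{A n}`,
so its mean is at most `t₀ / ε` (`lintegral_exitTime_le`).

The work lies in the Markov step (`IsSDESolution.mul_measure_le_setLIntegral`), since the solutions
are a bare family indexed by `x` on one space, with no assumed measurability in `x`. Euler schemes
with truncated coefficients do have an exact Markov property
(`IsBrownianMotion.setLIntegral_euler`): `n` steps act as the `n`-th iterate of an explicit Gaussian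
operator. The scheme restarted from `X (p * t)` converges to `X ((p + 1) * t)` as first `n → ∞` and
then the truncation radius tends to infinity. At `p = 0` this bounds the iterated liminf of the
iterates below by `ε` at each point of the ball; two applications of Fatou's lemma carry the bound
to the random point `X (p * t)`.

Convergence of the schemes (`IsSDESolution.exists_integral_cutNorm_sub_euler_le`) uses the Itô
integral only as a limit of Riemann sums. Each coarse step is divided into `m` fine ones. Up to the
oscillation of `X` within coarse steps and the error of the fine Riemann sums, `X` minus the scheme
is a finite sum of coefficient differences (`coeffDiffSum`), controlled in `L²` by independence of
increments and a discrete Gronwall inequality. The Riemann error vanishes as `m → ∞` with `n` fixed,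
the oscillation as `n → ∞`. No moments of `X` are available, so distances are measured by `min 1
‖·‖`. -/

/-! ### Discrete Gronwall inequality and a measurability fact. -/

/-- A discrete Gronwall inequality in which the increment at time `j` is controlled by the value at
the last multiple of `m` before `j`. -/
theorem blockwise_gronwall {M : ℕ → ℝ} {δ C A η : ℝ} {m J : ℕ} (hδ : 0 ≤ δ) (hC : 0 ≤ C)
    (hA : 0 ≤ A) (hη : 0 ≤ η) (h0 : M 0 = 0)
    (hM : ∀ j < J, M (j + 1) ≤ (1 + A * δ) * M j + C * δ * (η + M (m * (j / m)))) :
    ∀ j ≤ J, M j ≤ η * ((1 + (A + C) * δ) ^ j - 1) := by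
  intro j
  induction j using Nat.strong_induction_on with
  | _ j ih =>
    intro hj
    rcases j with _ | j
    · simp [h0]
    · have hq : 1 ≤ 1 + (A + C) * δ := by nlinarith [mul_nonneg (add_nonneg hA hC) hδ]
      have h1 := ih j (Nat.lt_succ_self j) (by omega)
      have hc : m * (j / m) ≤ j := Nat.mul_div_le j m
      have h2 := ih (m * (j / m)) (by omega) (by omega)
      have h3 : η * ((1 + (A + C) * δ) ^ (m * (j / m)) - 1) ≤ η * ((1 + (A + C) * δ) ^ j - 1) := by
        gcongr
      have h4 := hM j (by omega)
      have hAδ : 0 ≤ A * δ := mul_nonneg hA hδ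
      have hCδ : 0 ≤ C * δ := mul_nonneg hC hδ
      have h5 : (1 + A * δ) * M j ≤ (1 + A * δ) * (η * ((1 + (A + C) * δ) ^ j - 1)) := by gcongr
      have h6 : C * δ * (η + M (m * (j / m))) ≤
          C * δ * (η + η * ((1 + (A + C) * δ) ^ j - 1)) := by
        gcongr
        exact h2.trans h3
      have h7 : 0 ≤ η * (A * δ) := mul_nonneg hη hAδ
      calc M (j + 1) ≤ _ := h4
        _ ≤ _ := add_le_add h5 h6
        -- The two sides differ exactly by `η * (A * δ)`, which is `h7`.
        _ ≤ _ := by rw [pow_succ]; nlinarith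

theorem measurable_clm_apply {α : Type*} {mα : MeasurableSpace α} {k d : ℕ}
    {S : α → (EuclideanSpace ℝ (Fin k) →L[ℝ] EuclideanSpace ℝ (Fin d))}
    {v : α → EuclideanSpace ℝ (Fin k)} (hS : Measurable S) (hv : Measurable v) :
    Measurable fun ω => S ω (v ω) := by
  have h : Continuous fun p : (EuclideanSpace ℝ (Fin k) →L[ℝ] EuclideanSpace ℝ (Fin d)) ×
      EuclideanSpace ℝ (Fin k) => p.1 p.2 := continuous_fst.clm_apply continuous_snd
  exact h.measurable.comp (hS.prodMk hv)

/-! ### `L²` estimates for Brownian increments. -/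

section Brownian

variable {Ω : Type*} [mΩ : MeasurableSpace Ω] {P : Measure Ω}
  {F : Filtration ℝ≥0 mΩ} {k d : ℕ} {B : ℝ≥0 → Ω → EuclideanSpace ℝ (Fin k)}

/-- The second moment of the standard Gaussian measure. -/
noncomputable def gaussianSecondMoment (k : ℕ) : ℝ :=
  ∫ z, ‖z‖ ^ 2 ∂stdGaussian (EuclideanSpace ℝ (Fin k))

theorem gaussianSecondMoment_nonneg (k : ℕ) : 0 ≤ gaussianSecondMoment k :=
  integral_nonneg fun _ => by positivity

namespace IsBrownianMotion

theorem measurable_increment (hB : IsBrownianMotion P F B) (s t : ℝ≥0) :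
    Measurable fun ω => B t ω - B s ω :=
  ((hB.adapted t).mono (F.le t) le_rfl).sub ((hB.adapted s).mono (F.le s) le_rfl)

theorem indepFun_increment (hB : IsBrownianMotion P F B) {s t : ℝ≥0} (hst : s ≤ t)
    {α : Type*} [MeasurableSpace α] {U : Ω → α} (hU : Measurable[F s] U) :
    IndepFun U (fun ω => B t ω - B s ω) P := by
  rw [IndepFun_iff_Indep]
  exact indep_of_indep_of_le_left (hB.increment_indep s t hst).symm hU.comap_le

theorem memLp_increment (hB : IsBrownianMotion P F B) {s t : ℝ≥0} (hst : s ≤ t) :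
    MemLp (fun ω => B t ω - B s ω) 2 P := by
  have hmeas := hB.measurable_increment s t
  have h : MemLp id 2 (P.map fun ω => B t ω - B s ω) := by
    rw [hB.increment_law s t hst, memLp_map_measure_iff (by fun_prop) (by fun_prop)]
    exact (IsGaussian.memLp_id (stdGaussian (EuclideanSpace ℝ (Fin k))) 2 (by simp)).const_smul
      (Real.sqrt ((t : ℝ) - s))
  rwa [memLp_map_measure_iff (by fun_prop) hmeas.aemeasurable] at h

theorem integral_increment (hB : IsBrownianMotion P F B) {s t : ℝ≥0} (hst : s ≤ t) :
    ∫ ω, (B t ω - B s ω) ∂P = 0 := by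
  have hmeas := hB.measurable_increment s t
  have h := integral_map (μ := P) hmeas.aemeasurable (f := fun z => z) (by fun_prop)
  rw [← h, hB.increment_law s t hst, integral_map (by fun_prop) (by fun_prop), integral_smul,
    integral_id_stdGaussian, smul_zero]

theorem integral_norm_sq_increment (hB : IsBrownianMotion P F B) {s t : ℝ≥0} (hst : s ≤ t) :
    ∫ ω, ‖B t ω - B s ω‖ ^ 2 ∂P = ((t : ℝ) - s) * gaussianSecondMoment k := by
  have hmeas := hB.measurable_increment s t
  have h := integral_map (μ := P) hmeas.aemeasurable (f := fun z => ‖z‖ ^ 2) (by fun_prop)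
  rw [← h, hB.increment_law s t hst, integral_map (by fun_prop) (by fun_prop)]
  have hts : (0 : ℝ) ≤ (t : ℝ) - s := sub_nonneg.2 (by exact_mod_cast hst)
  simp only [norm_smul, mul_pow, Real.norm_eq_abs, sq_abs, Real.sq_sqrt hts]
  rw [integral_const_mul, gaussianSecondMoment]

theorem memLp_clm_increment (hB : IsBrownianMotion P F B) {s t : ℝ≥0} (hst : s ≤ t)
    {S : Ω → (EuclideanSpace ℝ (Fin k) →L[ℝ] EuclideanSpace ℝ (Fin d))}
    (hS : Measurable[F s] S) {K : ℝ} (hSK : ∀ ω, ‖S ω‖ ≤ K) :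
    MemLp (fun ω => S ω (B t ω - B s ω)) 2 P := by
  have hS' : Measurable S := hS.mono (F.le s) le_rfl
  have hmeas := hB.measurable_increment s t
  refine MemLp.of_le_mul (c := K) (hB.memLp_increment hst) ?_ (ae_of_all _ fun ω => ?_)
  · exact (measurable_clm_apply hS' hmeas).aestronglyMeasurable
  · exact ((S ω).le_opNorm _).trans (by gcongr; exact hSK ω)

/-- The `L²` estimate for adding a martingale increment to an adapted random vector. -/
theorem integral_norm_sq_add_clm_increment_le [IsProbabilityMeasure P]
    (hB : IsBrownianMotion P F B) {s t : ℝ≥0}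
    (hst : s ≤ t) {U : Ω → EuclideanSpace ℝ (Fin d)} (hU : Measurable[F s] U) (hU2 : MemLp U 2 P)
    {S : Ω → (EuclideanSpace ℝ (Fin k) →L[ℝ] EuclideanSpace ℝ (Fin d))}
    (hS : Measurable[F s] S) {K : ℝ} (hSK : ∀ ω, ‖S ω‖ ≤ K) :
    ∫ ω, ‖U ω + S ω (B t ω - B s ω)‖ ^ 2 ∂P ≤
      ∫ ω, ‖U ω‖ ^ 2 ∂P + ((t : ℝ) - s) * gaussianSecondMoment k * ∫ ω, ‖S ω‖ ^ 2 ∂P := by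
  have hS' : Measurable S := hS.mono (F.le s) le_rfl
  have hmeas := hB.measurable_increment s t
  have hSξ := hB.memLp_clm_increment hst hS hSK
  have hVm : Measurable[F s] fun ω => (S ω).adjoint (U ω) := by
    have h1 : Measurable[F s] fun ω => (S ω).adjoint :=
      (LinearIsometryEquiv.continuous _).measurable.comp hS
    exact measurable_clm_apply h1 hU
  have hV : Integrable (fun ω => (S ω).adjoint (U ω)) P := by
    refine Integrable.mono' ((hU2.integrable (by norm_num)).norm.const_mul K)
      (hVm.mono (F.le s) le_rfl).aestronglyMeasurable (ae_of_all _ fun ω => ?_)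
    refine ((S ω).adjoint.le_opNorm _).trans ?_
    rw [LinearIsometryEquiv.norm_map]
    gcongr
    exact hSK ω
  have hξ := (hB.memLp_increment hst).integrable (by norm_num)
  have hind := hB.indepFun_increment hst hVm
  -- Moving `S` to the other side as an adjoint pairs an `F s`-measurable vector with an independent
  -- centred increment.
  have hcross : ∫ ω, inner ℝ (U ω) (S ω (B t ω - B s ω)) ∂P = 0 := by
    have h := hind.integral_bilin hV hξ (innerSL ℝ)
    rw [hB.integral_increment hst, map_zero] at h
    rw [← h]
    exact integral_congr_ae (ae_of_all _ fun ω =>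
      (ContinuousLinearMap.adjoint_inner_left (S ω) _ _).symm)
  have hcrossI : Integrable (fun ω => inner ℝ (U ω) (S ω (B t ω - B s ω))) P :=
    (hind.integrable_bilin hV hξ (innerSL ℝ)).congr (ae_of_all _ fun ω =>
      ContinuousLinearMap.adjoint_inner_left (S ω) _ _)
  have hUI : Integrable (fun ω => ‖U ω‖ ^ 2) P := hU2.integrable_norm_pow (by norm_num)
  have hSI : Integrable (fun ω => ‖S ω (B t ω - B s ω)‖ ^ 2) P :=
    hSξ.integrable_norm_pow (by norm_num)
  have hSn : Integrable (fun ω => ‖S ω‖ ^ 2) P := by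
    refine Integrable.of_bound (hS'.norm.pow_const 2).aestronglyMeasurable (K ^ 2)
      (ae_of_all _ fun ω => ?_)
    rw [Real.norm_of_nonneg (by positivity)]
    gcongr
    exact hSK ω
  -- The operator norm replaces the Hilbert–Schmidt norm of the Itô isometry; the loss is harmless
  -- for Gronwall.
  have hsq : ∫ ω, ‖S ω (B t ω - B s ω)‖ ^ 2 ∂P ≤
      ((t : ℝ) - s) * gaussianSecondMoment k * ∫ ω, ‖S ω‖ ^ 2 ∂P := by
    have hind2 : IndepFun (fun ω => ‖S ω‖ ^ 2) (fun ω => ‖B t ω - B s ω‖ ^ 2) P :=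
      (hB.indepFun_increment hst hS).comp (φ := fun S => ‖S‖ ^ 2) (ψ := fun z => ‖z‖ ^ 2)
        (by fun_prop) (by fun_prop)
    have hξI := (hB.memLp_increment hst).integrable_norm_pow (by norm_num)
    have hprod := hind2.integrable_mul hSn hξI
    have h := hind2.integral_fun_mul_eq_mul_integral hSn.1 hξI.1
    rw [hB.integral_norm_sq_increment hst] at h
    rw [mul_comm, ← h]
    refine integral_mono hSI hprod fun ω => ?_
    simp only [← mul_pow]
    gcongr
    exact (S ω).le_opNorm _
  calc ∫ ω, ‖U ω + S ω (B t ω - B s ω)‖ ^ 2 ∂P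
      = ∫ ω, (‖U ω‖ ^ 2 + 2 * inner ℝ (U ω) (S ω (B t ω - B s ω))
          + ‖S ω (B t ω - B s ω)‖ ^ 2) ∂P := by
        simp only [norm_add_sq_real]
    _ = ∫ ω, ‖U ω‖ ^ 2 ∂P + ∫ ω, ‖S ω (B t ω - B s ω)‖ ^ 2 ∂P := by
        have hadd : Integrable
            (fun ω => ‖U ω‖ ^ 2 + 2 * inner ℝ (U ω) (S ω (B t ω - B s ω))) P :=
          hUI.add (hcrossI.const_mul 2)
        rw [integral_add hadd hSI, integral_add hUI
          (hcrossI.const_mul 2), integral_const_mul, hcross]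
        ring
    _ ≤ _ := by gcongr

end IsBrownianMotion

end Brownian

/-! ### One step of the comparison, localized to an adapted event. -/

section Brownian

variable {Ω : Type*} [mΩ : MeasurableSpace Ω] {P : Measure Ω} [IsProbabilityMeasure P]
  {F : Filtration ℝ≥0 mΩ} {k d : ℕ} {B : ℝ≥0 → Ω → EuclideanSpace ℝ (Fin k)}

theorem norm_add_smul_sq_le {V : Type*} [NormedAddCommGroup V] [InnerProductSpace ℝ V]
    (x y : V) {δ : ℝ} (hδ : 0 ≤ δ) :
    ‖x + δ • y‖ ^ 2 ≤ (1 + δ) * ‖x‖ ^ 2 + δ * (1 + δ) * ‖y‖ ^ 2 := by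
  rw [norm_add_sq_real, norm_smul, inner_smul_right, Real.norm_of_nonneg hδ]
  have h := real_inner_le_norm x y
  have h2 : δ * inner ℝ x y ≤ δ * (‖x‖ * ‖y‖) := by gcongr
  nlinarith [mul_nonneg hδ (sq_nonneg (‖x‖ - ‖y‖))]

/-- One step of the comparison of two Euler-type recursions, restricted to an adapted event. -/
theorem IsBrownianMotion.setIntegral_norm_sq_step_le (hB : IsBrownianMotion P F B) {s t : ℝ≥0}
    (hst : s ≤ t) {G : Set Ω} (hG : MeasurableSet[F s] G)
    {D β : Ω → EuclideanSpace ℝ (Fin d)} (hD : Measurable[F s] D) (hD2 : MemLp D 2 P)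
    (hβ : Measurable[F s] β)
    {S : Ω → (EuclideanSpace ℝ (Fin k) →L[ℝ] EuclideanSpace ℝ (Fin d))}
    (hS : Measurable[F s] S) {κ : Ω → ℝ} (hκ : Measurable κ) (hκ0 : ∀ ω, 0 ≤ κ ω)
    (hκ1 : ∀ ω, κ ω ≤ 1) {K : ℝ} (hK : 0 ≤ K)
    (hβK : ∀ ω, ‖β ω‖ ≤ 2 * K) (hSK : ∀ ω, ‖S ω‖ ≤ 2 * K)
    (hβG : ∀ ω ∈ G, ‖β ω‖ ≤ K * κ ω) (hSG : ∀ ω ∈ G, ‖S ω‖ ≤ K * κ ω) :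
    ∫ ω in G, ‖D ω + (((t : ℝ) - s) • β ω + S ω (B t ω - B s ω))‖ ^ 2 ∂P ≤
      (1 + ((t : ℝ) - s)) * ∫ ω in G, ‖D ω‖ ^ 2 ∂P +
        K ^ 2 * (1 + ((t : ℝ) - s) + gaussianSecondMoment k) * ((t : ℝ) - s) *
          ∫ ω in G, κ ω ^ 2 ∂P := by
  have hG' : MeasurableSet G := F.le s _ hG
  set δ : ℝ := (t : ℝ) - s with hδ
  have hδ0 : 0 ≤ δ := sub_nonneg.2 (by exact_mod_cast hst)
  have hc := gaussianSecondMoment_nonneg k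
  set c := gaussianSecondMoment k
  have hβ' : Measurable β := hβ.mono (F.le s) le_rfl
  have hβ2 : MemLp β 2 P := MemLp.of_bound hβ'.aestronglyMeasurable (2 * K) (ae_of_all _ hβK)
  have hsum : Measurable[F s] fun ω => D ω + δ • β ω := hD.add (hβ.const_smul δ)
  -- Since `G` is `F s`-measurable, its indicator can be absorbed into both `U` and `S` without
  -- losing adaptedness. The global bound `2 * K` serves integrability only; the size comes from the
  -- bounds on `G`.
  have hU2 : MemLp (G.indicator fun ω => D ω + δ • β ω) 2 P :=
    (hD2.add (hβ2.const_smul δ)).indicator hG'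
  have hmain := hB.integral_norm_sq_add_clm_increment_le hst (hsum.indicator hG) hU2
    (hS.indicator hG) (K := 2 * K) (fun ω => by
      by_cases h : ω ∈ G
      · simpa [h] using hSK ω
      · simp [h, hK])
  have hκI : Integrable (fun ω => κ ω ^ 2) P :=
    Integrable.of_bound (hκ.pow_const 2).aestronglyMeasurable 1 (ae_of_all _ fun ω => by
      rw [Real.norm_of_nonneg (by positivity)]
      exact pow_le_one₀ (hκ0 ω) (hκ1 ω))
  have e1 : ∫ ω, ‖G.indicator (fun ω => D ω + δ • β ω) ω + G.indicator S ω (B t ω - B s ω)‖ ^ 2 ∂P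
      = ∫ ω in G, ‖D ω + (δ • β ω + S ω (B t ω - B s ω))‖ ^ 2 ∂P := by
    rw [← integral_indicator hG']
    refine integral_congr_ae (ae_of_all _ fun ω => ?_)
    by_cases h : ω ∈ G
    · simp [h, add_assoc]
    · simp [h]
  have e2 : ∫ ω, ‖G.indicator (fun ω => D ω + δ • β ω) ω‖ ^ 2 ∂P
      = ∫ ω in G, ‖D ω + δ • β ω‖ ^ 2 ∂P := by
    rw [← integral_indicator hG']
    refine integral_congr_ae (ae_of_all _ fun ω => ?_)
    by_cases h : ω ∈ G <;> simp [h]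
  have e3 : ∫ ω, ‖G.indicator S ω‖ ^ 2 ∂P = ∫ ω in G, ‖S ω‖ ^ 2 ∂P := by
    rw [← integral_indicator hG']
    refine integral_congr_ae (ae_of_all _ fun ω => ?_)
    by_cases h : ω ∈ G <;> simp [h]
  rw [e1, e2, e3] at hmain
  have hDI : Integrable (fun ω => ‖D ω‖ ^ 2) P := hD2.integrable_norm_pow (by norm_num)
  have b1 : ∫ ω in G, ‖D ω + δ • β ω‖ ^ 2 ∂P ≤
      (1 + δ) * ∫ ω in G, ‖D ω‖ ^ 2 ∂P + δ * (1 + δ) * K ^ 2 * ∫ ω in G, κ ω ^ 2 ∂P := by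
    rw [← integral_const_mul, ← integral_const_mul, ← integral_add
      (hDI.integrableOn.const_mul _) (hκI.integrableOn.const_mul _)]
    refine setIntegral_mono_on ?_ ((hDI.integrableOn.const_mul _).add
      (hκI.integrableOn.const_mul _)) hG' fun ω hω => ?_
    · exact (((hD2.add (hβ2.const_smul δ)).integrable_norm_pow (by norm_num))).integrableOn
    · refine (norm_add_smul_sq_le _ _ hδ0).trans ?_
      have h := pow_le_pow_left₀ (norm_nonneg _) (hβG ω hω) 2
      rw [mul_pow] at h
      have := mul_le_mul_of_nonneg_left h (mul_nonneg hδ0 (by linarith : 0 ≤ 1 + δ))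
      linarith
  have b2 : ∫ ω in G, ‖S ω‖ ^ 2 ∂P ≤ K ^ 2 * ∫ ω in G, κ ω ^ 2 ∂P := by
    rw [← integral_const_mul]
    refine setIntegral_mono_on ?_ (hκI.integrableOn.const_mul _) hG' fun ω hω => ?_
    · refine Integrable.integrableOn (Integrable.of_bound
        ((hS.mono (F.le s) le_rfl).norm.pow_const 2).aestronglyMeasurable ((2 * K) ^ 2)
        (ae_of_all _ fun ω => ?_))
      rw [Real.norm_of_nonneg (by positivity)]
      exact pow_le_pow_left₀ (norm_nonneg _) (hSK ω) 2
    · rw [← mul_pow]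
      exact pow_le_pow_left₀ (norm_nonneg _) (hSG ω hω) 2
  have b3 := mul_le_mul_of_nonneg_left b2 (mul_nonneg hδ0 hc)
  linarith

end Brownian

/-! ### The cut-off norm. -/

/-- The norm cut off at height one. -/
noncomputable def cutNorm {V : Type*} [NormedAddCommGroup V] (v : V) : ℝ := min 1 ‖v‖

section CutNorm

variable {V : Type*} [NormedAddCommGroup V] (v w : V)

theorem cutNorm_nonneg : 0 ≤ cutNorm v := le_min zero_le_one (norm_nonneg v)

theorem cutNorm_le_one : cutNorm v ≤ 1 := min_le_left _ _

theorem cutNorm_le_norm : cutNorm v ≤ ‖v‖ := min_le_right _ _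

theorem cutNorm_add_le : cutNorm (v + w) ≤ cutNorm v + cutNorm w := by
  have h := norm_add_le v w
  have hv := norm_nonneg v
  have hw := norm_nonneg w
  unfold cutNorm
  rcases le_total 1 ‖v‖ with h1 | h1 <;> rcases le_total 1 ‖w‖ with h2 | h2 <;>
    simp only [min_eq_left, min_eq_right, h1, h2] <;> first
    | linarith [min_le_left 1 ‖v + w‖]
    | linarith [min_le_right 1 ‖v + w‖]

theorem cutNorm_neg : cutNorm (-v) = cutNorm v := by simp [cutNorm]

theorem continuous_cutNorm : Continuous (cutNorm : V → ℝ) := continuous_const.min continuous_norm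

theorem cutNorm_sq_le_one : cutNorm v ^ 2 ≤ 1 := pow_le_one₀ (cutNorm_nonneg v) (cutNorm_le_one v)

theorem integrable_cutNorm_sq {Ω : Type*} [MeasurableSpace Ω] {P : Measure Ω} [IsFiniteMeasure P]
    [MeasurableSpace V] [BorelSpace V] {f : Ω → V} (hf : Measurable f) :
    Integrable (fun ω => cutNorm (f ω) ^ 2) P :=
  Integrable.of_bound ((continuous_cutNorm.measurable.comp hf).pow_const 2).aestronglyMeasurable 1
    (ae_of_all _ fun ω => by
      rw [Real.norm_of_nonneg (by positivity)]
      exact cutNorm_sq_le_one _)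

end CutNorm

/-! ### Euler schemes and coefficient sums. -/

section Euler

variable {Ω : Type*} {k d : ℕ}
  (b : EuclideanSpace ℝ (Fin d) → EuclideanSpace ℝ (Fin d))
  (σ : EuclideanSpace ℝ (Fin d) → (EuclideanSpace ℝ (Fin k) →L[ℝ] EuclideanSpace ℝ (Fin d)))

/-- One step of the Euler scheme of step size `h`, with noise increment `z`. -/
noncomputable def eulerStep (h : ℝ) (y : EuclideanSpace ℝ (Fin d))
    (z : EuclideanSpace ℝ (Fin k)) : EuclideanSpace ℝ (Fin d) :=
  y + (h • b y + σ y z)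

/-- The Euler scheme of step size `h` started at `Y` and driven by the increments of `W`. -/
noncomputable def euler (h : ℝ) (Y : Ω → EuclideanSpace ℝ (Fin d))
    (W : ℕ → Ω → EuclideanSpace ℝ (Fin k)) : ℕ → Ω → EuclideanSpace ℝ (Fin d)
  | 0 => Y
  | i + 1 => fun ω => eulerStep b σ h (euler h Y W i ω) (W (i + 1) ω - W i ω)

/-- The left-point Riemann sums of the coefficients along a path `x`. -/
noncomputable def coeffSum (δ : ℝ) (x : ℕ → Ω → EuclideanSpace ℝ (Fin d))
    (V : ℕ → Ω → EuclideanSpace ℝ (Fin k)) (j : ℕ) (ω : Ω) : EuclideanSpace ℝ (Fin d) :=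
  ∑ l ∈ Finset.range j, (δ • b (x l ω) + σ (x l ω) (V (l + 1) ω - V l ω))

/-- The accumulated difference of the coefficients along `x` and along a coarser process `E`, which
is only evaluated at multiples of `m`. -/
noncomputable def coeffDiffSum (δ : ℝ) (m : ℕ) (x E : ℕ → Ω → EuclideanSpace ℝ (Fin d))
    (V : ℕ → Ω → EuclideanSpace ℝ (Fin k)) (j : ℕ) (ω : Ω) : EuclideanSpace ℝ (Fin d) :=
  ∑ l ∈ Finset.range j, (δ • (b (x l ω) - b (E (l / m) ω)) +
    (σ (x l ω) - σ (E (l / m) ω)) (V (l + 1) ω - V l ω))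

/-- Within a block of `m` fine steps the scheme is frozen, so the fine noise increments telescope to
the coarse one and the drifts add up to step size `m * δ`. At block ends the accumulated difference
is therefore a genuine difference of displacements. -/
theorem coeffDiffSum_mul {δ : ℝ} {m : ℕ} (hm : 0 < m) (x : ℕ → Ω → EuclideanSpace ℝ (Fin d))
    (Y : Ω → EuclideanSpace ℝ (Fin d)) (V : ℕ → Ω → EuclideanSpace ℝ (Fin k)) (i : ℕ) (ω : Ω) :
    coeffDiffSum b σ δ m x (euler b σ (m * δ) Y fun i => V (m * i)) V (m * i) ω =
      coeffSum b σ δ x V (m * i) ω - (euler b σ (m * δ) Y (fun i => V (m * i)) i ω - Y ω) := by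
  induction i with
  | zero => simp [coeffDiffSum, coeffSum, euler]
  | succ i ih =>
    set E := euler b σ (m * δ) Y fun i => V (m * i) with hE
    have hstep : E (i + 1) ω = E i ω +
        ((m * δ) • b (E i ω) + σ (E i ω) (V (m * (i + 1)) ω - V (m * i) ω)) := rfl
    have htel : V (m * (i + 1)) ω - V (m * i) ω =
        ∑ l ∈ Finset.range m, (V (m * i + l + 1) ω - V (m * i + l) ω) := by
      have h := Finset.sum_range_sub (fun l => V (m * i + l) ω) m
      simp only [← add_assoc, add_zero] at h
      rw [h, mul_add, mul_one]
    have hdiv : ∀ l ∈ Finset.range m, (m * i + l) / m = i := fun l hl => by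
      rw [Nat.mul_add_div hm, Nat.div_eq_of_lt (Finset.mem_range.1 hl), add_zero]
    have h1 : coeffDiffSum b σ δ m x E V (m * (i + 1)) ω = coeffDiffSum b σ δ m x E V (m * i) ω +
        ∑ l ∈ Finset.range m, (δ • (b (x (m * i + l) ω) - b (E i ω)) +
          (σ (x (m * i + l) ω) - σ (E i ω)) (V (m * i + l + 1) ω - V (m * i + l) ω)) := by
      unfold coeffDiffSum
      rw [mul_add, mul_one, Finset.sum_range_add]
      congr 1
      exact Finset.sum_congr rfl fun l hl => by rw [hdiv l hl]
    have h2 : coeffSum b σ δ x V (m * (i + 1)) ω = coeffSum b σ δ x V (m * i) ω +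
        ∑ l ∈ Finset.range m, (δ • b (x (m * i + l) ω) +
          σ (x (m * i + l) ω) (V (m * i + l + 1) ω - V (m * i + l) ω)) := by
      unfold coeffSum
      rw [mul_add, mul_one, Finset.sum_range_add]
    rw [h1, h2, ih, hstep, htel, map_sum]
    simp only [smul_sub, sub_apply, Finset.sum_add_distrib, Finset.sum_sub_distrib,
      Finset.sum_const, Finset.card_range, mul_smul, Nat.cast_smul_eq_nsmul]
    abel

theorem measurable_eulerStep {α : Type*} {mα : MeasurableSpace α} (hb : Measurable b)
    (hσ : Measurable σ) (h : ℝ) {y : α → EuclideanSpace ℝ (Fin d)}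
    {z : α → EuclideanSpace ℝ (Fin k)} (hy : Measurable y) (hz : Measurable z) :
    Measurable fun ω => eulerStep b σ h (y ω) (z ω) :=
  hy.add (((hb.comp hy).const_smul h).add (measurable_clm_apply (hσ.comp hy) hz))

theorem measurable_euler {𝒢 : ℕ → MeasurableSpace Ω} (h𝒢 : Monotone 𝒢) (hb : Measurable b)
    (hσ : Measurable σ) (h : ℝ) {Y : Ω → EuclideanSpace ℝ (Fin d)} (hY : Measurable[𝒢 0] Y)
    {W : ℕ → Ω → EuclideanSpace ℝ (Fin k)} (hW : ∀ i, Measurable[𝒢 i] (W i)) (i : ℕ) :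
    Measurable[𝒢 i] (euler b σ h Y W i) := by
  induction i with
  | zero => exact hY
  | succ i ih =>
    exact measurable_eulerStep b σ hb hσ h (ih.mono (h𝒢 i.le_succ) le_rfl)
      ((hW _).sub ((hW i).mono (h𝒢 i.le_succ) le_rfl))

theorem measurable_coeffSum {𝒢 : ℕ → MeasurableSpace Ω} (h𝒢 : Monotone 𝒢) (hb : Measurable b)
    (hσ : Measurable σ) (δ : ℝ) {x : ℕ → Ω → EuclideanSpace ℝ (Fin d)}
    (hx : ∀ j, Measurable[𝒢 j] (x j))
    {V : ℕ → Ω → EuclideanSpace ℝ (Fin k)} (hV : ∀ i, Measurable[𝒢 i] (V i)) (j : ℕ) :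
    Measurable[𝒢 j] (coeffSum b σ δ x V j) := by
  refine Finset.measurable_fun_sum _ fun l hl => ?_
  have hl' := Finset.mem_range.1 hl
  have hxl := (hx l).mono (h𝒢 hl'.le) le_rfl
  exact ((hb.comp hxl).const_smul δ).add (measurable_clm_apply (hσ.comp hxl)
    (((hV (l + 1)).mono (h𝒢 hl') le_rfl).sub ((hV l).mono (h𝒢 hl'.le) le_rfl)))

theorem measurable_coeffDiffSum {𝒢 : ℕ → MeasurableSpace Ω} (h𝒢 : Monotone 𝒢) (hb : Measurable b)
    (hσ : Measurable σ) (δ : ℝ) (m : ℕ) {x E : ℕ → Ω → EuclideanSpace ℝ (Fin d)}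
    (hx : ∀ j, Measurable[𝒢 j] (x j)) (hE : ∀ j, Measurable[𝒢 j] (E (j / m)))
    {V : ℕ → Ω → EuclideanSpace ℝ (Fin k)} (hV : ∀ i, Measurable[𝒢 i] (V i)) (j : ℕ) :
    Measurable[𝒢 j] (coeffDiffSum b σ δ m x E V j) := by
  refine Finset.measurable_fun_sum _ fun l hl => ?_
  have hl' := Finset.mem_range.1 hl
  have hxl := (hx l).mono (h𝒢 hl'.le) le_rfl
  have hEl := (hE l).mono (h𝒢 hl'.le) le_rfl
  exact (((hb.comp hxl).sub (hb.comp hEl)).const_smul δ).add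
    (measurable_clm_apply ((hσ.comp hxl).sub (hσ.comp hEl))
    (((hV (l + 1)).mono (h𝒢 hl') le_rfl).sub ((hV l).mono (h𝒢 hl'.le) le_rfl)))

end Euler

/-! ### Comparison of a process with its coarse Euler scheme. -/

section Comparison

variable {Ω : Type*} [mΩ : MeasurableSpace Ω] {P : Measure Ω} [IsProbabilityMeasure P]
  {F : Filtration ℝ≥0 mΩ} {k d : ℕ} {B : ℝ≥0 → Ω → EuclideanSpace ℝ (Fin k)}
  {b : EuclideanSpace ℝ (Fin d) → EuclideanSpace ℝ (Fin d)}
  {σ : EuclideanSpace ℝ (Fin d) → (EuclideanSpace ℝ (Fin k) →L[ℝ] EuclideanSpace ℝ (Fin d))}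

/-- Subadditivity and Cauchy–Schwarz. Only `r` keeps its full norm: it will be the sum to which the
`L²` recursion applies. -/
theorem cutNorm_sq_le_four {V : Type*} [NormedAddCommGroup V] {v w p q r : V}
    (h : v = w + p - q + r) :
    cutNorm v ^ 2 ≤ 4 * (cutNorm w ^ 2 + cutNorm p ^ 2 + cutNorm q ^ 2 + ‖r‖ ^ 2) := by
  have h1 := cutNorm_add_le (w + p - q) r
  have h2 := cutNorm_add_le (w + p) (-q)
  have h3 := cutNorm_add_le w p
  rw [cutNorm_neg, ← sub_eq_add_neg] at h2
  have h4 := cutNorm_le_norm r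
  have h0 := cutNorm_nonneg v
  rw [← h] at h1
  have h5 : cutNorm v ≤ cutNorm w + cutNorm p + cutNorm q + ‖r‖ := by linarith
  have h6 := pow_le_pow_left₀ h0 h5 2
  nlinarith [sq_nonneg (cutNorm w - cutNorm p), sq_nonneg (cutNorm w - cutNorm q),
    sq_nonneg (cutNorm w - ‖r‖), sq_nonneg (cutNorm p - cutNorm q),
    sq_nonneg (cutNorm p - ‖r‖), sq_nonneg (cutNorm q - ‖r‖)]

/-- The Euler scheme on a coarse grid is close to a process which is, on a finer grid, close to its
own coefficient sums and does not oscillate much between the points of the coarse grid. -/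
theorem IsBrownianMotion.setIntegral_cutNorm_sub_euler_le (hB : IsBrownianMotion P F B)
    (hb : Measurable b) (hσ : Measurable σ) {K : ℝ} (hK : 0 ≤ K) (hbK : ∀ y, ‖b y‖ ≤ K)
    (hσK : ∀ y, ‖σ y‖ ≤ K) {u : ℕ → ℝ≥0} {δ : ℝ≥0} (hu : ∀ j, u (j + 1) = u j + δ)
    {m n : ℕ} (hm : 0 < m) {x : ℕ → Ω → EuclideanSpace ℝ (Fin d)}
    (hx : ∀ j, Measurable[F (u j)] (x j)) {G : ℕ → Set Ω} (hG : ∀ j, MeasurableSet[F (u j)] (G j))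
    (hGanti : Antitone G)
    (hbL : ∀ j, ∀ ω ∈ G j, ∀ y, ‖b (x j ω) - b y‖ ≤ K * cutNorm (x j ω - y))
    (hσL : ∀ j, ∀ ω ∈ G j, ∀ y, ‖σ (x j ω) - σ y‖ ≤ K * cutNorm (x j ω - y))
    {Z : ℕ → Ω → EuclideanSpace ℝ (Fin d)} (hZ0 : Measurable (Z 0))
    (hZ : ∀ i ω, Z i ω = Z 0 ω + coeffSum b σ δ x (fun j => B (u j)) (m * i) ω)
    {ηw ηρ τ : ℝ} (hδτ : δ * (m * n : ℕ) ≤ τ) (hδ : δ ≤ τ)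
    (hw : ∀ j < m * n, ∫ ω, cutNorm (x j ω - x (m * (j / m)) ω) ^ 2 ∂P ≤ ηw)
    (hρ : ∀ i ≤ n, ∫ ω in G (m * i), cutNorm (x (m * i) ω - Z i ω) ^ 2 ∂P ≤ ηρ)
    (hηw : 0 ≤ ηw) :
    ∫ ω in G (m * n), cutNorm
        (x (m * n) ω - euler b σ (m * δ) (x 0) (fun i => B (u (m * i))) n ω) ^ 2 ∂P ≤
      4 * (ηw + 2 * ηρ) *
        (1 + Real.exp ((1 + 4 * (K ^ 2 * (1 + τ + gaussianSecondMoment k))) * τ)) := by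
  have hηρ : 0 ≤ ηρ := (integral_nonneg fun _ => by positivity).trans (hρ 0 (Nat.zero_le n))
  have hc := gaussianSecondMoment_nonneg k
  have hu_mono : Monotone u := monotone_nat_of_le_succ fun j => by rw [hu]; exact le_self_add
  have hF : Monotone fun j => F (u j) := fun i j hij => F.mono (hu_mono hij)
  have hV : ∀ j, Measurable[F (u j)] (B (u j)) := fun j => hB.adapted _
  set E := euler b σ (m * δ) (x 0) fun i => B (u (m * i)) with hEdef
  have hE : ∀ i, Measurable[F (u (m * i))] (E i) := fun i =>
    measurable_euler (𝒢 := fun i => F (u (m * i))) b σ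
      (fun i j hij => hF (Nat.mul_le_mul_left m hij)) hb hσ _ (hx 0) (fun i => hV _) i
  have hEdiv : ∀ j, Measurable[F (u j)] (E (j / m)) := fun j =>
    (hE (j / m)).mono (hF (Nat.mul_div_le j m)) le_rfl
  set D := coeffDiffSum b σ δ m x E fun j => B (u j) with hDdef
  have hD : ∀ j, Measurable[F (u j)] (D j) :=
    measurable_coeffDiffSum (𝒢 := fun j => F (u j)) b σ hF hb hσ δ m hx hEdiv hV
  have hbd : ∀ y z, ‖b y - b z‖ ≤ 2 * K := fun y z =>
    (norm_sub_le _ _).trans (by linarith [hbK y, hbK z])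
  have hσd : ∀ y z, ‖σ y - σ z‖ ≤ 2 * K := fun y z =>
    (norm_sub_le _ _).trans (by linarith [hσK y, hσK z])
  have hx' : ∀ j, Measurable (x j) := fun j => (hx j).mono (F.le _) le_rfl
  have hE' : ∀ i, Measurable (E i) := fun i => (hE i).mono (F.le _) le_rfl
  have hG' : ∀ j, MeasurableSet (G j) := fun j => F.le _ _ (hG j)
  have hDsucc : ∀ j ω, D (j + 1) ω = D j ω + ((δ : ℝ) • (b (x j ω) - b (E (j / m) ω)) +
      (σ (x j ω) - σ (E (j / m) ω)) (B (u (j + 1)) ω - B (u j) ω)) := fun j ω =>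
    Finset.sum_range_succ _ _
  have hβm : ∀ j, Measurable[F (u j)] fun ω => b (x j ω) - b (E (j / m) ω) := fun j =>
    (hb.comp (hx j)).sub (hb.comp (hEdiv j))
  have hSm : ∀ j, Measurable[F (u j)] fun ω => σ (x j ω) - σ (E (j / m) ω) := fun j =>
    (hσ.comp (hx j)).sub (hσ.comp (hEdiv j))
  have hD2 : ∀ j, MemLp (D j) 2 P := by
    intro j
    induction j with
    | zero =>
      have h0 : D 0 = fun _ => 0 := by
        ext1 ω
        simp [hDdef, coeffDiffSum]
      rw [h0]
      exact MemLp.zero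
    | succ j ih =>
      have h1 : MemLp (fun ω => b (x j ω) - b (E (j / m) ω)) 2 P :=
        MemLp.of_bound ((hβm j).mono (F.le _) le_rfl).aestronglyMeasurable (2 * K)
          (ae_of_all _ fun ω => hbd _ _)
      have h2 := hB.memLp_clm_increment (hu_mono j.le_succ) (hSm j) (K := 2 * K)
        (fun ω => hσd _ _)
      have h3 := ih.add ((h1.const_smul (δ : ℝ)).add h2)
      exact (memLp_congr_ae (ae_of_all _ fun ω => hDsucc j ω)).2 h3
  have hDI : ∀ j, Integrable (fun ω => ‖D j ω‖ ^ 2) P := fun j =>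
    (hD2 j).integrable_norm_pow (by norm_num)
  set Λ : ℝ := K ^ 2 * (1 + τ + gaussianSecondMoment k) with hΛ
  have hδ0 : (0 : ℝ) ≤ δ := δ.2
  have hτ0 : 0 ≤ τ := hδ0.trans hδ
  have hΛ0 : 0 ≤ Λ := by positivity
  have hZm : ∀ i, Measurable (Z i) := fun i => by
    have h := (measurable_coeffSum (𝒢 := fun j => F (u j)) b σ hF hb hσ δ hx hV (m * i)).mono
      (F.le _) le_rfl
    rw [show Z i = fun ω => _ from funext (hZ i)]
    exact hZ0.add h
  -- Oscillation since the last coarse time, plus Riemann error there, minus Riemann error at the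
  -- start, plus accumulated coefficient difference. The third term is present because `Z 0` need
  -- not equal `x 0`.
  have hid : ∀ j i ω, x j ω - E i ω = (x j ω - x (m * i) ω) + (x (m * i) ω - Z i ω) -
      (x (m * 0) ω - Z 0 ω) + D (m * i) ω := fun j i ω => by
    have h := coeffDiffSum_mul b σ (δ := δ) hm x (x 0) (fun j => B (u j)) i ω
    change D (m * i) ω = _ - (E i ω - x 0 ω) at h
    rw [h, hZ i ω, mul_zero]
    abel
  have hcutD : ∀ j i, m * i ≤ j → ∫ ω in G j, cutNorm (x j ω - E i ω) ^ 2 ∂P ≤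
      4 * (∫ ω, cutNorm (x j ω - x (m * i) ω) ^ 2 ∂P +
        ∫ ω in G (m * i), cutNorm (x (m * i) ω - Z i ω) ^ 2 ∂P +
        ∫ ω in G (m * 0), cutNorm (x (m * 0) ω - Z 0 ω) ^ 2 ∂P +
        ∫ ω in G (m * i), ‖D (m * i) ω‖ ^ 2 ∂P) := by
    intro j i hij
    have i1 : Integrable (fun ω => cutNorm (x j ω - x (m * i) ω) ^ 2) P :=
      integrable_cutNorm_sq ((hx' j).sub (hx' _))
    have i2 : Integrable (fun ω => cutNorm (x (m * i) ω - Z i ω) ^ 2) P :=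
      integrable_cutNorm_sq ((hx' _).sub (hZm i))
    have i3 : Integrable (fun ω => cutNorm (x (m * 0) ω - Z 0 ω) ^ 2) P :=
      integrable_cutNorm_sq ((hx' _).sub (hZm 0))
    have i12 : Integrable (fun ω => cutNorm (x j ω - x (m * i) ω) ^ 2 +
      cutNorm (x (m * i) ω - Z i ω) ^ 2) P := i1.add i2
    have i123 : Integrable (fun ω => cutNorm (x j ω - x (m * i) ω) ^ 2 +
      cutNorm (x (m * i) ω - Z i ω) ^ 2 + cutNorm (x (m * 0) ω - Z 0 ω) ^ 2) P := i12.add i3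
    have i1234 : Integrable (fun ω => cutNorm (x j ω - x (m * i) ω) ^ 2 +
      cutNorm (x (m * i) ω - Z i ω) ^ 2 + cutNorm (x (m * 0) ω - Z 0 ω) ^ 2 +
      ‖D (m * i) ω‖ ^ 2) P := i123.add (hDI _)
    calc ∫ ω in G j, cutNorm (x j ω - E i ω) ^ 2 ∂P
        ≤ ∫ ω in G j, 4 * (cutNorm (x j ω - x (m * i) ω) ^ 2 +
          cutNorm (x (m * i) ω - Z i ω) ^ 2 + cutNorm (x (m * 0) ω - Z 0 ω) ^ 2 +
          ‖D (m * i) ω‖ ^ 2) ∂P :=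
          setIntegral_mono_on (integrable_cutNorm_sq ((hx' j).sub (hE' i))).integrableOn
            (i1234.const_mul 4).integrableOn (hG' j) fun ω _ => cutNorm_sq_le_four (hid j i ω)
      _ = 4 * (∫ ω in G j, cutNorm (x j ω - x (m * i) ω) ^ 2 ∂P +
          ∫ ω in G j, cutNorm (x (m * i) ω - Z i ω) ^ 2 ∂P +
          ∫ ω in G j, cutNorm (x (m * 0) ω - Z 0 ω) ^ 2 ∂P +
          ∫ ω in G j, ‖D (m * i) ω‖ ^ 2 ∂P) := by
          rw [integral_const_mul, integral_add i123.integrableOn (hDI _).integrableOn,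
            integral_add i12.integrableOn i3.integrableOn,
            integral_add i1.integrableOn i2.integrableOn]
      _ ≤ _ := by
          have hsub : G j ≤ᵐ[P] G (m * i) := (hGanti hij).eventuallyLE
          have hsub0 : G j ≤ᵐ[P] G (m * 0) := (hGanti (by simp)).eventuallyLE
          refine mul_le_mul_of_nonneg_left (add_le_add (add_le_add (add_le_add ?_ ?_) ?_) ?_)
            (by norm_num)
          · exact setIntegral_le_integral i1 (ae_of_all _ fun ω => by positivity)
          · exact setIntegral_mono_set i2.integrableOn (ae_of_all _ fun ω => by positivity) hsub
          · exact setIntegral_mono_set i3.integrableOn (ae_of_all _ fun ω => by positivity) hsub0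
          · exact setIntegral_mono_set (hDI _).integrableOn
              (ae_of_all _ fun ω => by positivity) hsub
  -- `A = 1` comes from the drift cross term, the 4 in `C` from `cutNorm_sq_le_four`, and `2 * ηρ`
  -- from the Riemann errors at the two ends. Shrinking `G j` to `G (j + 1)` only decreases the
  -- integral.
  have hgron := blockwise_gronwall (M := fun j => ∫ ω in G j, ‖D j ω‖ ^ 2 ∂P) (δ := δ)
    (C := 4 * Λ) (A := 1) (η := ηw + 2 * ηρ) (m := m) (J := m * n) hδ0 (by positivity)
    zero_le_one (by positivity) (by simp [hDdef, coeffDiffSum]) (fun j hj => by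
      have hdiff : ((u (j + 1) : ℝ≥0) : ℝ) - u j = δ := by rw [hu]; push_cast; ring
      have hstep := hB.setIntegral_norm_sq_step_le (hu_mono j.le_succ) (hG j) (hD j) (hD2 j)
        (hβm j) (hSm j) (κ := fun ω => cutNorm (x j ω - E (j / m) ω))
        (continuous_cutNorm.measurable.comp ((hx' j).sub (hE' _))) (fun ω => cutNorm_nonneg _)
        (fun ω => cutNorm_le_one _) hK (fun ω => hbd _ _) (fun ω => hσd _ _)
        (fun ω hω => hbL j ω hω _) (fun ω hω => hσL j ω hω _)
      rw [hdiff] at hstep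
      simp only [← hDsucc] at hstep
      have hmono : ∫ ω in G (j + 1), ‖D (j + 1) ω‖ ^ 2 ∂P ≤ ∫ ω in G j, ‖D (j + 1) ω‖ ^ 2 ∂P :=
        setIntegral_mono_set (hDI _).integrableOn (ae_of_all _ fun ω => by positivity)
          (hGanti j.le_succ).eventuallyLE
      have hi : j / m ≤ n := (Nat.div_lt_of_lt_mul hj).le
      have hcut := hcutD j (j / m) (Nat.mul_div_le j m)
      have hw' := hw j hj
      have hρ' := hρ (j / m) hi
      have hρ0 := hρ 0 (Nat.zero_le n)
      have hcut' : ∫ ω in G j, cutNorm (x j ω - E (j / m) ω) ^ 2 ∂P ≤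
        4 * (ηw + 2 * ηρ + ∫ ω in G (m * (j / m)), ‖D (m * (j / m)) ω‖ ^ 2 ∂P) := by linarith
      have hΛδ : K ^ 2 * (1 + δ + gaussianSecondMoment k) * δ ≤ Λ * δ := by
        rw [hΛ]
        gcongr
      have hnn : 0 ≤ ∫ ω in G j, cutNorm (x j ω - E (j / m) ω) ^ 2 ∂P :=
        integral_nonneg fun _ => by positivity
      calc ∫ ω in G (j + 1), ‖D (j + 1) ω‖ ^ 2 ∂P ≤ _ := hmono.trans hstep
        _ ≤ (1 + δ) * ∫ ω in G j, ‖D j ω‖ ^ 2 ∂P + Λ * δ *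
            (4 * (ηw + 2 * ηρ + ∫ ω in G (m * (j / m)), ‖D (m * (j / m)) ω‖ ^ 2 ∂P)) := by
          gcongr
        _ = _ := by ring)
    (m * n) le_rfl
  have hexp : (1 + (1 + 4 * Λ) * δ) ^ (m * n) ≤ Real.exp ((1 + 4 * Λ) * τ) := by
    have h1 : 1 + (1 + 4 * Λ) * δ ≤ Real.exp ((1 + 4 * Λ) * δ) := by
      rw [add_comm]
      exact Real.add_one_le_exp _
    calc (1 + (1 + 4 * Λ) * δ) ^ (m * n) ≤ Real.exp ((1 + 4 * Λ) * δ) ^ (m * n) := by gcongr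
      _ = Real.exp ((1 + 4 * Λ) * (δ * (m * n : ℕ))) := by
        rw [← Real.exp_nat_mul]
        congr 1
        ring
      _ ≤ _ := by gcongr
  -- The last time is itself a coarse time, so the oscillation term vanishes there.
  have hfin := hcutD (m * n) n le_rfl
  have hz : ∫ ω, cutNorm (x (m * n) ω - x (m * n) ω) ^ 2 ∂P = 0 := by simp [cutNorm]
  have h1 := hρ n le_rfl
  have h2 := hρ 0 (Nat.zero_le n)
  have h3 : (ηw + 2 * ηρ) * ((1 + (1 + 4 * Λ) * δ) ^ (m * n) - 1) ≤
      (ηw + 2 * ηρ) * Real.exp ((1 + 4 * Λ) * τ) := by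
    gcongr
    linarith
  linarith

end Comparison

/-! ### Truncated coefficients and Riemann sums. -/

/-- The function `g`, set to zero outside the closed ball of radius `R + 1`. -/
noncomputable def truncated {d : ℕ} {V : Type*} [Zero V] (R : ℝ)
    (g : EuclideanSpace ℝ (Fin d) → V) : EuclideanSpace ℝ (Fin d) → V :=
  (Metric.closedBall 0 (R + 1)).indicator g

theorem truncated_of_norm_le {d : ℕ} {V : Type*} [Zero V] {R : ℝ}
    (g : EuclideanSpace ℝ (Fin d) → V) {y : EuclideanSpace ℝ (Fin d)} (hy : ‖y‖ ≤ R) :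
    truncated R g y = g y :=
  Set.indicator_of_mem (by simpa using hy.trans (by linarith)) g

/-- If `‖x - y‖ ≤ 1`, both points lie in the ball of radius `R + 1`, where `g` is Lipschitz by
compactness; otherwise twice the sup bound suffices. The unit margin in `truncated` thus lets `y` be
arbitrary, although truncation may create a jump. -/
theorem LocallyLipschitz.exists_truncated_bound {d : ℕ} {V : Type*} [NormedAddCommGroup V]
    {g : EuclideanSpace ℝ (Fin d) → V} (hg : LocallyLipschitz g) (R : ℝ) :
    ∃ K : ℝ, 0 ≤ K ∧ (∀ y, ‖truncated R g y‖ ≤ K) ∧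
      ∀ x y, ‖x‖ ≤ R → ‖truncated R g x - truncated R g y‖ ≤ K * cutNorm (x - y) := by
  have hcpt := isCompact_closedBall (0 : EuclideanSpace ℝ (Fin d)) (R + 1)
  obtain ⟨L, hL⟩ := (hg.locallyLipschitzOn).exists_lipschitzOnWith_of_compact hcpt
  obtain ⟨M₀, hM₀⟩ := hcpt.exists_bound_of_continuousOn hg.continuous.continuousOn
  have hL0 : (0 : ℝ) ≤ L := L.2
  obtain ⟨M, hM0, hM⟩ : ∃ M : ℝ, 0 ≤ M ∧ ∀ y, ‖truncated R g y‖ ≤ M := by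
    refine ⟨max M₀ 0, le_max_right _ _, fun y => ?_⟩
    by_cases hy : y ∈ Metric.closedBall (0 : EuclideanSpace ℝ (Fin d)) (R + 1)
    · rw [truncated, Set.indicator_of_mem hy]
      exact (hM₀ y hy).trans (le_max_left _ _)
    · rw [truncated, Set.indicator_of_notMem hy, norm_zero]
      exact le_max_right _ _
  refine ⟨L + 2 * M, by positivity, fun y => (hM y).trans (by linarith), fun x y hx => ?_⟩
  have hcrude : ‖truncated R g x - truncated R g y‖ ≤ 2 * M :=
    (norm_sub_le _ _).trans (by linarith [hM x, hM y])
  rcases le_total 1 ‖x - y‖ with h1 | h1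
  · rw [cutNorm, min_eq_left h1]
    linarith
  · rw [cutNorm, min_eq_right h1]
    have hxm : x ∈ Metric.closedBall (0 : EuclideanSpace ℝ (Fin d)) (R + 1) := by
      simpa using hx.trans (by linarith)
    have hym : y ∈ Metric.closedBall (0 : EuclideanSpace ℝ (Fin d)) (R + 1) := by
      have h2 : ‖y‖ ≤ ‖x‖ + ‖x - y‖ := by
        rw [norm_sub_rev]
        exact norm_le_norm_add_norm_sub' y x
      simpa using h2.trans (by linarith)
    rw [truncated, Set.indicator_of_mem hxm, Set.indicator_of_mem hym]
    have h3 := hL.norm_sub_le hxm hym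
    nlinarith [norm_nonneg (x - y), mul_nonneg hM0 (norm_nonneg (x - y))]

theorem measurable_truncated {d : ℕ} {V : Type*} [NormedAddCommGroup V] [MeasurableSpace V]
    [BorelSpace V] {g : EuclideanSpace ℝ (Fin d) → V} (hg : Continuous g) (R : ℝ) :
    Measurable (truncated R g) :=
  hg.measurable.indicator Metric.isClosed_closedBall.measurableSet

/-- Left-point Riemann sums of a continuous function over uniform grids converge. -/
theorem tendsto_riemannSum {V : Type*} [NormedAddCommGroup V] [NormedSpace ℝ V] [CompleteSpace V]
    {g : ℝ≥0 → V} (hg : Continuous g) (t : ℝ≥0) {N : ℕ → ℕ} {δ : ℕ → ℝ≥0}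
    (hN : ∀ m, N m * δ m = t) (hδ : Tendsto δ atTop (𝓝 0)) :
    Tendsto (fun m => ∑ l ∈ Finset.range (N m), (δ m : ℝ) • g (l * δ m)) atTop
      (𝓝 (∫ s in (0 : ℝ)..t, g s.toNNReal)) := by
  set f : ℝ → V := fun s => g s.toNNReal with hf
  have hfc : Continuous f := hg.comp continuous_real_toNNReal
  have huc := (isCompact_Icc (a := (0 : ℝ)) (b := t)).uniformContinuousOn_of_continuous
    hfc.continuousOn
  rw [Metric.uniformContinuousOn_iff] at huc
  rw [Metric.tendsto_nhds]
  intro ε hε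
  obtain ⟨γ, hγ, hγ'⟩ := huc (ε / (t + 1)) (by positivity)
  have hev : ∀ᶠ m in atTop, δ m < γ.toNNReal := hδ.eventually_lt_const (by simpa using hγ)
  filter_upwards [hev] with m hm
  have hm' : (δ m : ℝ) < γ := Real.lt_toNNReal_iff_coe_lt.1 hm
  have hδ0 : (0 : ℝ) ≤ δ m := (δ m).2
  have hNt : (N m : ℝ) * δ m = t := by exact_mod_cast congrArg (fun r : ℝ≥0 => (r : ℝ)) (hN m)
  have hint : ∀ a c : ℝ, IntervalIntegrable f volume a c := fun a c => hfc.intervalIntegrable a c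
  have hsplit : ∫ s in (0 : ℝ)..t, f s =
      ∑ l ∈ Finset.range (N m), ∫ s in ((l : ℝ) * δ m)..(((l + 1 : ℕ) : ℝ) * δ m), f s := by
    rw [intervalIntegral.sum_integral_adjacent_intervals (a := fun l : ℕ => (l : ℝ) * δ m)
      fun l _ => hint _ _]
    simp [hNt]
  have hterm : ∀ l ∈ Finset.range (N m), ‖(δ m : ℝ) • g (l * δ m) -
      ∫ s in ((l : ℝ) * δ m)..(((l + 1 : ℕ) : ℝ) * δ m), f s‖ ≤ ε / (t + 1) * δ m := by
    intro l hl
    have hlN : ((l + 1 : ℕ) : ℝ) ≤ N m := by exact_mod_cast Finset.mem_range.1 hl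
    have hgl : g (l * δ m) = f (l * δ m) := by
      simp only [hf]
      congr 1
      rw [Real.toNNReal_mul (by positivity)]
      simp
    have hle : (l : ℝ) * δ m ≤ ((l + 1 : ℕ) : ℝ) * δ m := by gcongr; simp
    have hlen : ((l + 1 : ℕ) : ℝ) * δ m - l * δ m = δ m := by push_cast; ring
    have hconst : (δ m : ℝ) • g (l * δ m) =
        ∫ s in ((l : ℝ) * δ m)..(((l + 1 : ℕ) : ℝ) * δ m), f (l * δ m) := by
      rw [intervalIntegral.integral_const, hlen, hgl]
    rw [hconst, ← intervalIntegral.integral_sub (by simp) (hint _ _)]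
    refine (intervalIntegral.norm_integral_le_of_norm_le_const (C := ε / (t + 1))
      fun s hs => ?_).trans ?_
    · rw [Set.uIoc_of_le hle] at hs
      have hl0 : 0 ≤ (l : ℝ) * δ m := by positivity
      have hst : s ≤ t := hs.2.trans (by rw [← hNt]; gcongr)
      rw [← dist_eq_norm]
      refine (hγ' _ ⟨hl0, ?_⟩ _ ⟨hl0.trans hs.1.le, hst⟩ ?_).le
      · exact hs.1.le.trans hst
      · rw [dist_comm, Real.dist_eq, abs_of_nonneg (by linarith [hs.1])]
        linarith [hs.2]
    · rw [hlen, abs_of_nonneg hδ0]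
  rw [hsplit, dist_eq_norm, ← Finset.sum_sub_distrib]
  calc _ ≤ ∑ l ∈ Finset.range (N m), ε / (t + 1) * δ m := norm_sum_le_of_le _ hterm
    _ = ε / (t + 1) * t := by
      rw [Finset.sum_const, Finset.card_range, nsmul_eq_mul, ← hNt]
      ring
    _ < ε := by
      have ht : (0 : ℝ) ≤ t := t.2
      rw [div_mul_eq_mul_div, div_lt_iff₀ (by positivity)]
      nlinarith

/-! ### A solution as the limit of its own coefficient sums. -/

section Solution

variable {Ω : Type*} [mΩ : MeasurableSpace Ω] {P : Measure Ω} [IsProbabilityMeasure P]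
  {F : Filtration ℝ≥0 mΩ} {k d : ℕ} {B : ℝ≥0 → Ω → EuclideanSpace ℝ (Fin k)}
  {b : EuclideanSpace ℝ (Fin d) → EuclideanSpace ℝ (Fin d)}
  {σ : EuclideanSpace ℝ (Fin d) → (EuclideanSpace ℝ (Fin k) →L[ℝ] EuclideanSpace ℝ (Fin d))}

omit [IsProbabilityMeasure P] in
theorem IsItoIntegral.tendstoInMeasure_uniform
    {H : ℝ≥0 → Ω → (EuclideanSpace ℝ (Fin k) →L[ℝ] EuclideanSpace ℝ (Fin d))}
    {I : ℝ≥0 → Ω → EuclideanSpace ℝ (Fin d)} (hI : IsItoIntegral P B H I) (t : ℝ≥0) {N : ℕ → ℕ}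
    {δ : ℕ → ℝ≥0} (hN : ∀ m, N m * δ m = t) (hδ : Tendsto δ atTop (𝓝 0)) :
    TendstoInMeasure P (fun m ω => ∑ l ∈ Finset.range (N m),
      H (l * δ m) ω (B ((l + 1 : ℕ) * δ m) ω - B (l * δ m) ω)) atTop (I t) := by
  have h := hI t N (fun m l => ((min l (N m) : ℕ) : ℝ≥0) * δ m)
    (fun m => ⟨fun i j hij => by gcongr, by simp, by simp [hN]⟩)
    (fun ε hε => by
      have hev : ∀ᶠ m in atTop, δ m < ε.toNNReal := hδ.eventually_lt_const (by simpa using hε)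
      filter_upwards [hev] with m hm i hi
      rw [min_eq_left hi.le, min_eq_left (Nat.succ_le_of_lt hi)]
      have := Real.lt_toNNReal_iff_coe_lt.1 hm
      push_cast
      linarith)
  refine h.congr_left fun m => ae_of_all _ fun ω => Finset.sum_congr rfl fun l hl => ?_
  have hl' := Finset.mem_range.1 hl
  rw [min_eq_left hl'.le, min_eq_left (Nat.succ_le_of_lt hl')]

/-- The left-point coefficient sums along a solution converge to the solution in probability. -/
theorem IsSDESolution.tendsto_measureReal_coeffSum (hb : Continuous b) {x : EuclideanSpace ℝ (Fin d)}
    {X : ℝ≥0 → Ω → EuclideanSpace ℝ (Fin d)} (hX : IsSDESolution P F B b σ x X) (t : ℝ≥0)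
    {N : ℕ → ℕ} {δ : ℕ → ℝ≥0} (hN : ∀ m, N m * δ m = t) (hδ : Tendsto δ atTop (𝓝 0)) {θ : ℝ}
    (hθ : 0 < θ) :
    Tendsto (fun m => P.real {ω | θ ≤ ‖X t ω - (x + coeffSum b σ (δ m) (fun l => X (l * δ m))
      (fun l => B (l * δ m)) (N m) ω)‖}) atTop (𝓝 0) := by
  obtain ⟨I, hI, heq⟩ := hX.equation
  have hXm : ∀ s, Measurable (X s) := fun s => (hX.adapted s).mono (F.le s) le_rfl
  have h1 := hI.tendstoInMeasure_uniform t hN hδ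
  have h2 : TendstoInMeasure P (fun m ω => ∑ l ∈ Finset.range (N m), (δ m : ℝ) • b (X (l * δ m) ω))
      atTop (fun ω => ∫ s in (0 : ℝ)..t, b (X s.toNNReal ω)) := by
    refine tendstoInMeasure_of_tendsto_ae (fun m => ?_) (ae_of_all _ fun ω => ?_)
    · exact (Finset.measurable_fun_sum _ fun l _ =>
        (hb.measurable.comp (hXm _)).const_smul (δ m : ℝ)).aestronglyMeasurable
    · exact tendsto_riemannSum (hb.comp (hX.continuous_paths ω)) t hN hδ
  have h1' := tendstoInMeasure_iff_measureReal_norm.1 h1 (θ / 2) (by positivity)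
  have h2' := tendstoInMeasure_iff_measureReal_norm.1 h2 (θ / 2) (by positivity)
  have hsum := h1'.add h2'
  rw [add_zero] at hsum
  refine squeeze_zero (fun _ => measureReal_nonneg) (fun m => ?_) hsum
  refine le_trans ?_ (measureReal_union_le _ _)
  refine ENNReal.toReal_mono (measure_ne_top _ _) (measure_mono_ae ?_)
  filter_upwards [heq t] with ω hω hmem
  change θ ≤ _ at hmem
  rw [hω] at hmem
  have hexp : coeffSum b σ (δ m) (fun l => X (l * δ m)) (fun l => B (l * δ m)) (N m) ω =
      (∑ l ∈ Finset.range (N m), (δ m : ℝ) • b (X (l * δ m) ω)) +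
      ∑ l ∈ Finset.range (N m), σ (X (l * δ m) ω)
        (B ((l + 1 : ℕ) * δ m) ω - B (l * δ m) ω) := by
    simp only [coeffSum, Finset.sum_add_distrib]
  rw [hexp] at hmem
  have htri : ∀ p q r s : EuclideanSpace ℝ (Fin d),
      ‖x + p + q - (x + (r + s))‖ ≤ ‖s - q‖ + ‖r - p‖ := fun p q r s => by
    rw [show x + p + q - (x + (r + s)) = -((s - q) + (r - p)) by abel, norm_neg]
    exact norm_add_le _ _
  have := hmem.trans (htri _ _ _ _)
  by_contra hcon
  have hcon' := not_or.1 hcon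
  have h3 := not_le.1 (show ¬θ / 2 ≤ _ from hcon'.1)
  have h4 := not_le.1 (show ¬θ / 2 ≤ _ from hcon'.2)
  linarith

/-- On `G` the truncated sums coincide with the untruncated ones, whose convergence in probability
is known. The threshold for `m` is independent of `G`, which allows `G` to be defined from the grid
itself. -/
theorem IsSDESolution.eventually_setIntegral_cutNorm_le (hB : IsBrownianMotion P F B)
    (hb : Continuous b) (hσ : Continuous σ) {x : EuclideanSpace ℝ (Fin d)}
    {X : ℝ≥0 → Ω → EuclideanSpace ℝ (Fin d)} (hX : IsSDESolution P F B b σ x X) (t : ℝ≥0)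
    {N : ℕ → ℕ} {δ : ℕ → ℝ≥0} (hN : ∀ m, N m * δ m = t) (hδ : Tendsto δ atTop (𝓝 0)) (R : ℝ)
    {η : ℝ} (hη : 0 < η) :
    ∀ᶠ m in atTop, ∀ G : Set Ω, MeasurableSet G →
      (∀ ω ∈ G, ∀ l < N m, ‖X (l * δ m) ω‖ ≤ R) →
      ∫ ω in G, cutNorm (X t ω - (x + coeffSum (truncated R b) (truncated R σ) (δ m)
        (fun l => X (l * δ m)) (fun l => B (l * δ m)) (N m) ω)) ^ 2 ∂P ≤ η := by
  have hXm : ∀ s, Measurable (X s) := fun s => (hX.adapted s).mono (F.le s) le_rfl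
  have hBm : ∀ s, Measurable (B s) := fun s => (hB.adapted s).mono (F.le s) le_rfl
  -- `θ ≤ 1` ensures that `cutNorm ^ 2 ≤ θ` wherever the norm is below `θ`; the exceptional event
  -- contributes the other `η / 2`.
  set θ : ℝ := min 1 (η / 2) with hθdef
  have hθ : 0 < θ := lt_min one_pos (by positivity)
  have hconv := hX.tendsto_measureReal_coeffSum hb t hN hδ hθ
  filter_upwards [hconv.eventually_lt_const (show 0 < η / 2 by positivity)] with m hm G hG hGR
  set S : Ω → EuclideanSpace ℝ (Fin d) := fun ω => X t ω - (x + coeffSum b σ (δ m)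
    (fun l => X (l * δ m)) (fun l => B (l * δ m)) (N m) ω) with hS
  have hSm : Measurable S := (hXm t).sub (measurable_const.add
    (measurable_coeffSum (𝒢 := fun _ => mΩ) b σ (fun _ _ _ => le_rfl) hb.measurable hσ.measurable
      _ (fun _ => hXm _) (fun _ => hBm _) _))
  have hbad : MeasurableSet {ω | θ ≤ ‖S ω‖} := measurableSet_le measurable_const hSm.norm
  have hcongr : ∫ ω in G, cutNorm (X t ω - (x + coeffSum (truncated R b) (truncated R σ) (δ m)
      (fun l => X (l * δ m)) (fun l => B (l * δ m)) (N m) ω)) ^ 2 ∂P =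
      ∫ ω in G, cutNorm (S ω) ^ 2 ∂P := by
    refine setIntegral_congr_fun hG fun ω hω => ?_
    have : coeffSum (truncated R b) (truncated R σ) (δ m) (fun l => X (l * δ m))
        (fun l => B (l * δ m)) (N m) ω = coeffSum b σ (δ m) (fun l => X (l * δ m))
        (fun l => B (l * δ m)) (N m) ω := by
      refine Finset.sum_congr rfl fun l hl => ?_
      have hle := hGR ω hω l (Finset.mem_range.1 hl)
      rw [truncated_of_norm_le b hle, truncated_of_norm_le σ hle]
    simp only [hS, this]
  rw [hcongr]
  have hI := integrable_cutNorm_sq (P := P) hSm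
  calc ∫ ω in G, cutNorm (S ω) ^ 2 ∂P ≤ ∫ ω, cutNorm (S ω) ^ 2 ∂P :=
        setIntegral_le_integral hI (ae_of_all _ fun ω => by positivity)
    _ ≤ ∫ ω, (θ + {ω | θ ≤ ‖S ω‖}.indicator (fun _ => (1 : ℝ)) ω) ∂P := by
        refine integral_mono hI ((integrable_const _).add
          ((integrable_const _).indicator hbad)) fun ω => ?_
        dsimp only
        by_cases hω : θ ≤ ‖S ω‖
        · rw [Set.indicator_of_mem (show ω ∈ {ω | θ ≤ ‖S ω‖} from hω)]
          linarith [cutNorm_sq_le_one (S ω)]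
        · rw [Set.indicator_of_notMem (show ω ∉ {ω | θ ≤ ‖S ω‖} from hω), add_zero]
          push Not at hω
          have h1 := cutNorm_le_norm (S ω)
          have h2 := cutNorm_nonneg (S ω)
          have h3 : θ ≤ 1 := min_le_left _ _
          nlinarith
    _ = θ + P.real {ω | θ ≤ ‖S ω‖} := by
        rw [integral_add (integrable_const _) ((integrable_const _).indicator hbad),
          integral_indicator_const _ hbad]
        simp
    _ ≤ η := by
        have : θ ≤ η / 2 := min_le_right _ _
        linarith

end Solution

/-! ### Escape and oscillation of continuous paths along rational times. -/

section PathRegularity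

variable {Ω : Type*} {d : ℕ}

/-- The event that `X` leaves the ball of radius `R` at a rational multiple `q * t` of `t` with
`q ≤ N`. -/
def escapeSet (X : ℝ≥0 → Ω → EuclideanSpace ℝ (Fin d)) (t : ℝ≥0) (N : ℕ) (R : ℝ) : Set Ω :=
  ⋃ (q : ℚ≥0) (_ : q ≤ N), {ω | R < ‖X (q * t) ω‖}

/-- The squared oscillation of `X`, cut off at height one, between rational multiples of `t` in
`[0, N * t]` at distance at most `t / n`. -/
noncomputable def pathOscillation (X : ℝ≥0 → Ω → EuclideanSpace ℝ (Fin d)) (t : ℝ≥0) (N n : ℕ)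
    (ω : Ω) : ℝ≥0∞ :=
  ⨆ (q : ℚ≥0) (r : ℚ≥0) (_ : q ≤ r ∧ r ≤ q + 1 / n ∧ r ≤ N),
    ENNReal.ofReal (cutNorm (X (r * t) ω - X (q * t) ω) ^ 2)

theorem measurableSet_escapeSet [MeasurableSpace Ω] {X : ℝ≥0 → Ω → EuclideanSpace ℝ (Fin d)}
    (hX : ∀ t, Measurable (X t)) (t : ℝ≥0) (N : ℕ) (R : ℝ) :
    MeasurableSet (escapeSet X t N R) :=
  .iUnion fun _ => .iUnion fun _ => measurableSet_lt measurable_const (hX _).norm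

theorem measurable_pathOscillation [MeasurableSpace Ω]
    {X : ℝ≥0 → Ω → EuclideanSpace ℝ (Fin d)}
    (hX : ∀ t, Measurable (X t)) (t : ℝ≥0) (N n : ℕ) : Measurable (pathOscillation X t N n) :=
  .iSup fun _ => .iSup fun _ => .iSup fun _ =>
    ((continuous_cutNorm.measurable.comp ((hX _).sub (hX _))).pow_const 2).ennreal_ofReal

theorem pathOscillation_le_one (X : ℝ≥0 → Ω → EuclideanSpace ℝ (Fin d)) (t : ℝ≥0) (N n : ℕ)
    (ω : Ω) : pathOscillation X t N n ω ≤ 1 :=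
  iSup_le fun _ => iSup_le fun _ => iSup_le fun _ =>
    ENNReal.ofReal_le_one.2 (cutNorm_sq_le_one _)

/-- A continuous path is bounded on `[0, N * t]`, so these events decrease to the empty set. -/
theorem tendsto_measureReal_escapeSet [MeasurableSpace Ω] {P : Measure Ω} [IsProbabilityMeasure P]
    {X : ℝ≥0 → Ω → EuclideanSpace ℝ (Fin d)} (hX : ∀ t, Measurable (X t))
    (hc : ∀ ω, Continuous fun t => X t ω) (t : ℝ≥0) (N : ℕ) :
    Tendsto (fun R : ℕ => P.real (escapeSet X t N R)) atTop (𝓝 0) := by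
  have hanti : Antitone fun R : ℕ => escapeSet X t N R := fun R S hRS =>
    Set.iUnion_mono fun q => Set.iUnion_mono fun _ => fun ω hω => by
      have h : (S : ℝ) < ‖X (q * t) ω‖ := hω
      have h' : (R : ℝ) ≤ S := by exact_mod_cast hRS
      exact h'.trans_lt h
  have hempty : ⋂ R : ℕ, escapeSet X t N R = ∅ := by
    refine Set.eq_empty_of_forall_notMem fun ω hω => ?_
    obtain ⟨M, hM⟩ := (isCompact_Icc (a := (0 : ℝ≥0)) (b := N * t)).exists_bound_of_continuousOn
      (hc ω).continuousOn
    obtain ⟨R, hR⟩ := exists_nat_ge M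
    have h := Set.mem_iInter.1 hω R
    simp only [escapeSet, Set.mem_iUnion] at h
    obtain ⟨q, hq, h⟩ := h
    have h1 : (R : ℝ) < ‖X (q * t) ω‖ := h
    have hq' : (q : ℝ≥0) ≤ N := by exact_mod_cast hq
    exact absurd ((hM (q * t) ⟨zero_le, by gcongr⟩).trans hR) (not_le.2 h1)
  have h := tendsto_measure_iInter_atTop (μ := P)
    (fun R : ℕ => (measurableSet_escapeSet hX t N R).nullMeasurableSet) hanti
    ⟨0, measure_ne_top _ _⟩
  rw [hempty, measure_empty] at h
  exact (ENNReal.tendsto_toReal ENNReal.zero_ne_top).comp h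

theorem tendsto_pathOscillation {X : ℝ≥0 → Ω → EuclideanSpace ℝ (Fin d)} {ω : Ω}
    (hc : Continuous fun t => X t ω) (t : ℝ≥0) (N : ℕ) :
    Tendsto (fun n => pathOscillation X t N n ω) atTop (𝓝 0) := by
  have huc := (isCompact_Icc (a := (0 : ℝ≥0)) (b := N * t)).uniformContinuousOn_of_continuous
    hc.continuousOn
  rw [Metric.uniformContinuousOn_iff] at huc
  rw [ENNReal.tendsto_atTop_zero]
  intro ε hε
  obtain ⟨e, he, heε⟩ : ∃ e : ℝ, 0 < e ∧ ENNReal.ofReal e ≤ ε := by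
    rcases eq_or_ne ε ∞ with rfl | h
    · exact ⟨1, one_pos, le_top⟩
    · exact ⟨ε.toReal, ENNReal.toReal_pos hε.ne' h, ENNReal.ofReal_toReal_le⟩
  obtain ⟨γ, hγ, hγ'⟩ := huc e he
  obtain ⟨n₀, hn₀⟩ := exists_nat_gt ((t : ℝ) / γ)
  refine ⟨n₀ + 1, fun n hn => iSup_le fun q => iSup_le fun r => iSup_le fun hqr => ?_⟩
  obtain ⟨hqr, hrq, hrN⟩ := hqr
  refine le_trans (ENNReal.ofReal_le_ofReal ?_) heε
  have hqr' : ((q : ℝ≥0) : ℝ) ≤ (r : ℝ≥0) := by exact_mod_cast hqr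
  have hrq' : ((r : ℝ≥0) : ℝ) ≤ (q : ℝ≥0) + 1 / n := by
    have h := (NNRat.cast_le (K := ℝ≥0)).2 hrq
    push_cast at h
    exact_mod_cast h
  have hrN' : (r : ℝ≥0) ≤ N := by exact_mod_cast hrN
  have hqN' : (q : ℝ≥0) ≤ N := by exact_mod_cast hqr.trans hrN
  have hn' : (n₀ : ℝ) + 1 ≤ n := by exact_mod_cast hn
  have hnpos : (0 : ℝ) < n := by have : (0 : ℝ) ≤ n₀ := n₀.cast_nonneg; linarith
  have ht : (0 : ℝ) ≤ t := t.2
  have hd : dist ((r : ℝ≥0) * t) ((q : ℝ≥0) * t) < γ := by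
    rw [NNReal.dist_eq, abs_of_nonneg (by simp only [NNReal.coe_mul]; nlinarith)]
    simp only [NNReal.coe_mul]
    have h1 : (t : ℝ) / n < γ := by
      rw [div_lt_iff₀ hnpos]
      rw [div_lt_iff₀ hγ] at hn₀
      nlinarith
    have h2 : ((r : ℝ≥0) : ℝ) * t - (q : ℝ≥0) * t ≤ t / n := by
      rw [div_eq_mul_one_div, ← sub_mul, mul_comm]
      gcongr
      linarith
    exact h2.trans_lt h1
  have hlt := hγ' _ ⟨zero_le, mul_le_mul_left hrN' t⟩ _ ⟨zero_le, mul_le_mul_left hqN' t⟩ hd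
  rw [dist_eq_norm] at hlt
  have h1 := cutNorm_le_norm (X (r * t) ω - X (q * t) ω)
  have h2 := cutNorm_nonneg (X (r * t) ω - X (q * t) ω)
  have h3 := cutNorm_le_one (X (r * t) ω - X (q * t) ω)
  nlinarith

theorem tendsto_toReal_lintegral_pathOscillation [MeasurableSpace Ω] {P : Measure Ω}
    [IsProbabilityMeasure P] {X : ℝ≥0 → Ω → EuclideanSpace ℝ (Fin d)}
    (hX : ∀ t, Measurable (X t)) (hc : ∀ ω, Continuous fun t => X t ω) (t : ℝ≥0) (N : ℕ) :
    Tendsto (fun n => (∫⁻ ω, pathOscillation X t N n ω ∂P).toReal) atTop (𝓝 0) := by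
  have h := tendsto_lintegral_of_dominated_convergence (μ := P) (fun _ => (1 : ℝ≥0∞))
    (fun n => measurable_pathOscillation hX t N n)
    (fun n => ae_of_all _ fun ω => pathOscillation_le_one X t N n ω) (by simp)
    (ae_of_all _ fun ω => tendsto_pathOscillation (hc ω) t N)
  rw [lintegral_zero] at h
  exact (ENNReal.tendsto_toReal ENNReal.zero_ne_top).comp h

/-- Every time `j * t / (m * n)` is a rational multiple of `t`, so one countable supremum controls
all fine grids at once and the bound does not depend on `m`. -/
theorem integral_cutNorm_sq_le_pathOscillation [MeasurableSpace Ω] {P : Measure Ω}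
    [IsProbabilityMeasure P] {X : ℝ≥0 → Ω → EuclideanSpace ℝ (Fin d)}
    (hX : ∀ t, Measurable (X t)) {t s₁ s₂ : ℝ≥0} {N n : ℕ} {q r : ℚ≥0} (hqr : q ≤ r)
    (hrq : r ≤ q + 1 / n) (hrN : r ≤ N) (h₁ : s₁ = r * t) (h₂ : s₂ = q * t) :
    ∫ ω, cutNorm (X s₁ ω - X s₂ ω) ^ 2 ∂P ≤ (∫⁻ ω, pathOscillation X t N n ω ∂P).toReal := by
  subst h₁ h₂
  have hm : Measurable fun ω => cutNorm (X (r * t) ω - X (q * t) ω) ^ 2 :=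
    (continuous_cutNorm.measurable.comp ((hX _).sub (hX _))).pow_const 2
  rw [integral_eq_lintegral_of_nonneg_ae (ae_of_all _ fun ω => by positivity)
    hm.aestronglyMeasurable]
  refine ENNReal.toReal_mono ?_ (lintegral_mono fun ω => ?_)
  · refine ((lintegral_mono fun ω => pathOscillation_le_one X t N n ω).trans_lt ?_).ne
    simp
  · exact le_iSup_of_le q (le_iSup_of_le r (le_iSup_of_le ⟨hqr, hrq, hrN⟩ le_rfl))

end PathRegularity

/-! ### Convergence of the truncated Euler schemes. -/

section EulerError

variable {Ω : Type*} [mΩ : MeasurableSpace Ω] {P : Measure Ω} [IsProbabilityMeasure P]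
  {F : Filtration ℝ≥0 mΩ} {k d : ℕ} {B : ℝ≥0 → Ω → EuclideanSpace ℝ (Fin k)}
  {b : EuclideanSpace ℝ (Fin d) → EuclideanSpace ℝ (Fin d)}
  {σ : EuclideanSpace ℝ (Fin d) → (EuclideanSpace ℝ (Fin k) →L[ℝ] EuclideanSpace ℝ (Fin d))}

/-- The truncated Euler scheme with `n` steps, started from the solution at time `p * t`, is close
to the solution at time `(p + 1) * t`. -/
theorem IsSDESolution.exists_integral_cutNorm_sub_euler_le (hB : IsBrownianMotion P F B)
    (hb : LocallyLipschitz b) (hσ : LocallyLipschitz σ) {x : EuclideanSpace ℝ (Fin d)}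
    {X : ℝ≥0 → Ω → EuclideanSpace ℝ (Fin d)} (hX : IsSDESolution P F B b σ x X) (t : ℝ≥0)
    (p : ℕ) (R : ℝ) :
    ∃ C : ℝ, ∀ n : ℕ, 0 < n →
      ∫ ω, cutNorm (X ((p + 1 : ℕ) * t) ω - euler (truncated R b) (truncated R σ)
        ((t / n : ℝ≥0) : ℝ) (X (p * t)) (fun i => B ((p * n + i : ℕ) * (t / n))) n ω) ^ 2 ∂P ≤
      P.real (escapeSet X t (p + 1) R) +
        C * (∫⁻ ω, pathOscillation X t (p + 1) n ω ∂P).toReal := by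
  have hXm : ∀ s, Measurable (X s) := fun s => (hX.adapted s).mono (F.le s) le_rfl
  have hBm : ∀ s, Measurable (B s) := fun s => (hB.adapted s).mono (F.le s) le_rfl
  obtain ⟨K₁, hK₁, hb1, hb2⟩ := hb.exists_truncated_bound R
  obtain ⟨K₂, hK₂, hσ1, hσ2⟩ := hσ.exists_truncated_bound R
  have hbm := measurable_truncated hb.continuous R
  have hσm := measurable_truncated hσ.continuous R
  set K := max K₁ K₂ with hKdef
  have hK : 0 ≤ K := hK₁.trans (le_max_left _ _)
  set A : ℝ := 4 * (1 + Real.exp ((1 + 4 * (K ^ 2 * (1 + t + gaussianSecondMoment k))) * t)) with hA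
  have hA0 : 0 < A := by positivity
  -- The fine grid does not occur in the claim, so it may be chosen depending on `ε`. With `ηρ = ε /
  -- (2 * A)` the Riemann errors contribute exactly `ε`.
  refine ⟨A, fun n hn => le_of_forall_pos_le_add fun ε hε => ?_⟩
  set ηw := (∫⁻ ω, pathOscillation X t (p + 1) n ω ∂P).toReal with hηw
  set ηρ : ℝ := ε / (2 * A) with hηρ
  have hηρ0 : 0 < ηρ := by positivity
  have hn' : (n : ℝ≥0) ≠ 0 := by exact_mod_cast hn.ne'
  -- One fine grid must serve all `n + 1` coarse times of `[p * t, (p + 1) * t]`. It starts at time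
  -- 0, where the integral equation starts; `M + 1` keeps the number of subdivisions positive.
  have hev : ∀ᶠ M : ℕ in atTop, ∀ i ∈ Finset.range (n + 1), ∀ G : Set Ω, MeasurableSet G →
      (∀ ω ∈ G, ∀ l < (M + 1) * (p * n + i), ‖X (l * (t / n / (M + 1 : ℕ))) ω‖ ≤ R) →
      ∫ ω in G, cutNorm (X ((p * n + i : ℕ) * (t / n)) ω - (x + coeffSum (truncated R b)
        (truncated R σ) ((t / n / (M + 1 : ℕ) : ℝ≥0) : ℝ) (fun l => X (l * (t / n / (M + 1 : ℕ))))
        (fun l => B (l * (t / n / (M + 1 : ℕ)))) ((M + 1) * (p * n + i)) ω)) ^ 2 ∂P ≤ ηρ := by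
    rw [eventually_all_finset]
    intro i _
    refine hX.eventually_setIntegral_cutNorm_le hB hb.continuous hσ.continuous
      ((p * n + i : ℕ) * (t / n)) (N := fun M => (M + 1) * (p * n + i))
      (δ := fun M => t / n / (M + 1 : ℕ)) (fun M => ?_) ?_ R hηρ0
    · have hM : ((M + 1 : ℕ) : ℝ≥0) ≠ 0 := by positivity
      rw [Nat.cast_mul]
      field_simp
    · exact (tendsto_const_div_atTop_nhds_zero_nat (t / n)).comp (tendsto_add_atTop_nat 1)
  obtain ⟨M, hM⟩ := hev.exists
  set m : ℕ := M + 1 with hm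
  have hm0 : 0 < m := M.succ_pos
  have hm' : (m : ℝ≥0) ≠ 0 := by exact_mod_cast hm0.ne'
  set δ : ℝ≥0 := t / n / m with hδ
  set r : ℕ := m * (p * n) with hr
  have htime : ∀ i : ℕ, ((r + m * i : ℕ) : ℝ≥0) * δ = (p * n + i : ℕ) * (t / n) := fun i => by
    rw [hδ, hr, ← mul_add, Nat.cast_mul]
    field_simp
  have hstart : ((r + 0 : ℕ) : ℝ≥0) * δ = p * t := by
    have h := htime 0
    rw [mul_zero, add_zero] at h
    rw [add_zero, h, Nat.cast_add, Nat.cast_mul, Nat.cast_zero, add_zero]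
    field_simp
  have hend : ((r + m * n : ℕ) : ℝ≥0) * δ = (p + 1 : ℕ) * t := by
    rw [htime n]
    push_cast
    field_simp
  have hmδ : (m : ℝ) * δ = ((t / n : ℝ≥0) : ℝ) := by
    rw [← NNReal.coe_natCast, ← NNReal.coe_mul]
    congr 1
    rw [hδ]
    field_simp
  -- The past is included back to time 0 because the coefficient sums are taken from there; only
  -- grid times enter, so the event is adapted.
  set G : ℕ → Set Ω := fun j => {ω | ∀ l ≤ r + j, ‖X (l * δ) ω‖ ≤ R} with hGdef
  have hGm : ∀ j, MeasurableSet[F ((r + j : ℕ) * δ)] (G j) := fun j => by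
    have : G j = ⋂ (l : ℕ) (_ : l ≤ r + j), {ω | ‖X (l * δ) ω‖ ≤ R} := by
      ext ω
      simp [hGdef]
    rw [this]
    refine .iInter fun l => .iInter fun hl => ?_
    have h1 : Measurable[F ((r + j : ℕ) * δ)] (X (l * δ)) :=
      (hX.adapted _).mono (F.mono (by gcongr)) le_rfl
    exact h1 (isClosed_le continuous_norm continuous_const).measurableSet
  have hGm' : ∀ j, MeasurableSet (G j) := fun j => F.le _ _ (hGm j)
  have hGle : ∀ j, ∀ ω ∈ G j, ∀ l ≤ r + j, ‖X (l * δ) ω‖ ≤ R := fun j ω hω => hω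
  have hδt : δ * (m * n : ℕ) = t := by
    rw [hδ]
    push_cast
    field_simp
  have hmn1 : (1 : ℝ≥0) ≤ (m * n : ℕ) := by exact_mod_cast Nat.succ_le_of_lt (Nat.mul_pos hm0 hn)
  have hmain := hB.setIntegral_cutNorm_sub_euler_le (b := truncated R b) (σ := truncated R σ)
    hbm hσm hK
    (fun y => (hb1 y).trans (le_max_left _ _)) (fun y => (hσ1 y).trans (le_max_right _ _))
    (u := fun j => (r + j : ℕ) * δ) (δ := δ) (fun j => by push_cast; ring) (m := m) (n := n) hm0
    (x := fun j => X ((r + j : ℕ) * δ)) (fun j => hX.adapted _) (G := G) hGm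
    (fun i j hij ω hω l hl => hω l (hl.trans (by omega)))
    (fun j ω hω y => (hb2 _ y (hGle j ω hω _ le_rfl)).trans
      (mul_le_mul_of_nonneg_right (le_max_left _ _) (cutNorm_nonneg _)))
    (fun j ω hω y => (hσ2 _ y (hGle j ω hω _ le_rfl)).trans
      (mul_le_mul_of_nonneg_right (le_max_right _ _) (cutNorm_nonneg _)))
    (Z := fun i ω => x + coeffSum (truncated R b) (truncated R σ) δ (fun l => X (l * δ))
      (fun l => B (l * δ)) (r + m * i) ω)
    (measurable_const.add (measurable_coeffSum (𝒢 := fun _ => mΩ) _ _ (fun _ _ _ => le_rfl)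
      hbm hσm _ (fun _ => hXm _) (fun _ => hBm _) _))
    (fun i ω => by
      simp only [coeffSum, mul_zero, add_zero]
      rw [Finset.sum_range_add, add_assoc]
      rfl)
    (ηw := ηw) (ηρ := ηρ) (τ := t) (by exact_mod_cast hδt.le)
    (by
      have : δ ≤ t := by
        calc δ = δ * 1 := (mul_one _).symm
          _ ≤ δ * (m * n : ℕ) := by gcongr
          _ = t := hδt
      exact_mod_cast this)
    (fun j hj => by
      have hmn : (m : ℚ≥0) * n ≠ 0 := by
        have := (Nat.mul_pos hm0 hn).ne'
        exact_mod_cast this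
      have hnq : (n : ℚ≥0) ≠ 0 := by exact_mod_cast hn.ne'
      have hmq : (m : ℚ≥0) ≠ 0 := by exact_mod_cast hm0.ne'
      refine integral_cutNorm_sq_le_pathOscillation hXm (N := p + 1) (n := n)
        (q := (r + m * (j / m) : ℕ) / (m * n)) (r := (r + j : ℕ) / (m * n)) ?_ ?_ ?_ ?_ ?_
      · gcongr
        exact Nat.mul_div_le j m
      · have h1 : r + j ≤ r + m * (j / m) + m := by
          have := Nat.div_add_mod j m
          have := Nat.mod_lt j hm0
          omega
        have h2 : ((r + j : ℕ) : ℚ≥0) ≤ (r + m * (j / m) : ℕ) + m := by exact_mod_cast h1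
        calc ((r + j : ℕ) : ℚ≥0) / (m * n) ≤ ((r + m * (j / m) : ℕ) + m) / (m * n) := by gcongr
          _ = (r + m * (j / m) : ℕ) / (m * n) + 1 / n := by
            rw [add_div]
            congr 1
            field_simp
      · rw [div_le_iff₀ (by positivity)]
        have h1 : r + j ≤ (p + 1) * (m * n) := by
          rw [hr]
          nlinarith
        exact_mod_cast h1
      · rw [hδ]
        push_cast
        field_simp
      · rw [hδ]
        push_cast
        field_simp)
    (fun i hi => by
      rw [htime i, hr, ← mul_add]
      refine hM i (Finset.mem_range.2 (by omega)) _ (hGm' _) fun ω hω l hl => ?_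
      exact hGle _ ω hω l (by rw [hr, ← mul_add]; exact hl.le))
    ENNReal.toReal_nonneg
  simp only [hend, hstart, hmδ, htime] at hmain
  set E := euler (truncated R b) (truncated R σ) ((t / n : ℝ≥0) : ℝ) (X (p * t))
    (fun i => B ((p * n + i : ℕ) * (t / n))) n with hE
  have hEm : Measurable E := measurable_euler (𝒢 := fun _ => mΩ) _ _ (fun _ _ _ => le_rfl)
    hbm hσm _ (hXm _) (fun _ => hBm _) _
  have hI : Integrable (fun ω => cutNorm (X ((p + 1 : ℕ) * t) ω - E ω) ^ 2) P :=
    integrable_cutNorm_sq ((hXm _).sub hEm)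
  have hsub : (G (m * n))ᶜ ⊆ escapeSet X t (p + 1) R := fun ω hω => by
    have hω' : ¬∀ l ≤ r + m * n, ‖X (l * δ) ω‖ ≤ R := hω
    push Not at hω'
    obtain ⟨l, hl, hlR⟩ := hω'
    have hl' : l ≤ (p + 1) * (m * n) := hl.trans (by rw [hr]; nlinarith)
    refine Set.mem_iUnion₂.2 ⟨(l : ℚ≥0) / (m * n), ?_, ?_⟩
    · have : (0 : ℚ≥0) < m * n := by exact_mod_cast Nat.mul_pos hm0 hn
      rw [div_le_iff₀ this]
      exact_mod_cast hl'
    · have htl : (((l : ℚ≥0) / (m * n) : ℚ≥0) : ℝ≥0) * t = l * δ := by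
        rw [hδ]
        push_cast
        field_simp
      change R < ‖X (_ * t) ω‖
      rwa [htl]
  have hcompl : ∫ ω in (G (m * n))ᶜ, cutNorm (X ((p + 1 : ℕ) * t) ω - E ω) ^ 2 ∂P ≤
      P.real (escapeSet X t (p + 1) R) := by
    calc _ ≤ ∫ ω in (G (m * n))ᶜ, (1 : ℝ) ∂P :=
          setIntegral_mono hI.integrableOn (integrable_const _).integrableOn
            fun ω => cutNorm_sq_le_one _
      _ = P.real (G (m * n))ᶜ := by simp
      _ ≤ _ := measureReal_mono hsub
  rw [← integral_add_compl (hGm' (m * n)) hI]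
  have hε' : 2 * ηρ * A = ε := by
    rw [hηρ]
    field_simp
  rw [show 4 * (ηw + 2 * ηρ) * (1 + Real.exp ((1 + 4 * (K ^ 2 * (1 + t +
    gaussianSecondMoment k))) * t)) = A * ηw + 2 * ηρ * A by rw [hA]; ring, hε'] at hmain
  linarith

/-- Convergence of the truncated Euler schemes to the solution, in the iterated limit of step size
to zero and then truncation radius to infinity. -/
theorem IsSDESolution.eventually_integral_cutNorm_sub_euler_le (hB : IsBrownianMotion P F B)
    (hb : LocallyLipschitz b) (hσ : LocallyLipschitz σ) {x : EuclideanSpace ℝ (Fin d)}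
    {X : ℝ≥0 → Ω → EuclideanSpace ℝ (Fin d)} (hX : IsSDESolution P F B b σ x X) (t : ℝ≥0)
    (p : ℕ) {η : ℝ} (hη : 0 < η) :
    ∀ᶠ R : ℕ in atTop, ∀ᶠ n : ℕ in atTop,
      ∫ ω, cutNorm (X ((p + 1 : ℕ) * t) ω - euler (truncated R b) (truncated R σ)
        ((t / n : ℝ≥0) : ℝ) (X (p * t)) (fun i => B ((p * n + i : ℕ) * (t / n))) n ω) ∂P ≤ η := by
  have hXm : ∀ s, Measurable (X s) := fun s => (hX.adapted s).mono (F.le s) le_rfl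
  have hBm : ∀ s, Measurable (B s) := fun s => (hB.adapted s).mono (F.le s) le_rfl
  -- Two errors of this size give mean square at most `(η / 2) ^ 2`, and `c ≤ η / 2 + (2 / η) * c ^
  -- 2` turns this into `η`.
  have hθ : 0 < (η / 2) ^ 2 / 2 := by positivity
  filter_upwards [(tendsto_measureReal_escapeSet (P := P) hXm hX.continuous_paths t
    (p + 1)).eventually_lt_const hθ] with R hR
  obtain ⟨C, hC⟩ := hX.exists_integral_cutNorm_sub_euler_le hB hb hσ t p R
  have hosc := (tendsto_toReal_lintegral_pathOscillation (P := P) hXm hX.continuous_paths t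
    (p + 1)).const_mul C
  rw [mul_zero] at hosc
  filter_upwards [hosc.eventually_lt_const hθ, eventually_gt_atTop 0] with n hn hn0
  have hsq := hC n hn0
  set E := euler (truncated R b) (truncated R σ) ((t / n : ℝ≥0) : ℝ) (X (p * t))
    (fun i => B ((p * n + i : ℕ) * (t / n))) n with hE
  have hEm : Measurable E := measurable_euler (𝒢 := fun _ => mΩ) _ _ (fun _ _ _ => le_rfl)
    (measurable_truncated hb.continuous R) (measurable_truncated hσ.continuous R) _ (hXm _)
    (fun _ => hBm _) _
  have hI : Integrable (fun ω => cutNorm (X ((p + 1 : ℕ) * t) ω - E ω) ^ 2) P :=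
    integrable_cutNorm_sq ((hXm _).sub hEm)
  have hI1 : Integrable (fun ω => cutNorm (X ((p + 1 : ℕ) * t) ω - E ω)) P :=
    Integrable.of_bound (continuous_cutNorm.measurable.comp ((hXm _).sub hEm)).aestronglyMeasurable
      1 (ae_of_all _ fun ω => by
        rw [Real.norm_of_nonneg (cutNorm_nonneg _)]
        exact cutNorm_le_one _)
  calc ∫ ω, cutNorm (X ((p + 1 : ℕ) * t) ω - E ω) ∂P
      ≤ ∫ ω, (η / 2 + (2 / η) * cutNorm (X ((p + 1 : ℕ) * t) ω - E ω) ^ 2) ∂P := by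
        refine integral_mono hI1 ((integrable_const _).add (hI.const_mul _)) fun ω => ?_
        set c := cutNorm (X ((p + 1 : ℕ) * t) ω - E ω)
        have h1 : η / 2 + 2 / η * c ^ 2 - c = (2 / η) * ((c - η / 4) ^ 2 + 3 * η ^ 2 / 16) := by
          field_simp
          ring
        have h2 : 0 ≤ (2 / η) * ((c - η / 4) ^ 2 + 3 * η ^ 2 / 16) := by positivity
        change c ≤ η / 2 + 2 / η * c ^ 2
        linarith
    _ = η / 2 + (2 / η) * ∫ ω, cutNorm (X ((p + 1 : ℕ) * t) ω - E ω) ^ 2 ∂P := by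
        rw [integral_add (integrable_const _) (hI.const_mul _), integral_const_mul]
        simp
    _ ≤ η / 2 + (2 / η) * ((η / 2) ^ 2) := by
        gcongr
        linarith
    _ = η := by
        field_simp
        ring

end EulerError

/-! ### The Markov property through Euler operators. -/

section Markov

variable {Ω : Type*} [mΩ : MeasurableSpace Ω] {P : Measure Ω} [IsProbabilityMeasure P]
  {F : Filtration ℝ≥0 mΩ} {k d : ℕ} {B : ℝ≥0 → Ω → EuclideanSpace ℝ (Fin k)}
  {b : EuclideanSpace ℝ (Fin d) → EuclideanSpace ℝ (Fin d)}
  {σ : EuclideanSpace ℝ (Fin d) → (EuclideanSpace ℝ (Fin k) →L[ℝ] EuclideanSpace ℝ (Fin d))}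

/-- The transition operator of the Euler scheme of step size `h`. -/
noncomputable def eulerOperator (b : EuclideanSpace ℝ (Fin d) → EuclideanSpace ℝ (Fin d))
    (σ : EuclideanSpace ℝ (Fin d) → (EuclideanSpace ℝ (Fin k) →L[ℝ] EuclideanSpace ℝ (Fin d)))
    (h : ℝ≥0) (φ : EuclideanSpace ℝ (Fin d) → ℝ≥0∞) (y : EuclideanSpace ℝ (Fin d)) : ℝ≥0∞ :=
  ∫⁻ z, φ (eulerStep b σ h y (Real.sqrt h • z)) ∂stdGaussian (EuclideanSpace ℝ (Fin k))

theorem measurable_eulerOperator (hb : Measurable b) (hσ : Measurable σ) (h : ℝ≥0)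
    {φ : EuclideanSpace ℝ (Fin d) → ℝ≥0∞} (hφ : Measurable φ) :
    Measurable (eulerOperator b σ h φ) :=
  Measurable.lintegral_prod_right' (f := fun p : EuclideanSpace ℝ (Fin d) ×
    EuclideanSpace ℝ (Fin k) => φ (eulerStep b σ h p.1 (Real.sqrt h • p.2)))
    (hφ.comp (measurable_eulerStep b σ hb hσ h measurable_fst (by fun_prop)))

theorem measurable_eulerOperator_iterate (hb : Measurable b) (hσ : Measurable σ) (h : ℝ≥0)
    {φ : EuclideanSpace ℝ (Fin d) → ℝ≥0∞} (hφ : Measurable φ) (n : ℕ) :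
    Measurable ((eulerOperator b σ h)^[n] φ) := by
  induction n with
  | zero => exact hφ
  | succ n ih =>
    rw [Function.iterate_succ_apply']
    exact measurable_eulerOperator hb hσ h ih

/-- The pair formed by the indicator of `A` and `U` is independent of the increment, so the joint
law is a product and Tonelli integrates the Gaussian first. -/
theorem IsBrownianMotion.setLIntegral_eulerStep (hB : IsBrownianMotion P F B)
    (hb : Measurable b) (hσ : Measurable σ) (s h : ℝ≥0)
    {φ : EuclideanSpace ℝ (Fin d) → ℝ≥0∞} (hφ : Measurable φ)
    {U : Ω → EuclideanSpace ℝ (Fin d)} (hU : Measurable[F s] U) {A : Set Ω}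
    (hA : MeasurableSet[F s] A) :
    ∫⁻ ω in A, φ (eulerStep b σ h (U ω) (B (s + h) ω - B s ω)) ∂P =
      ∫⁻ ω in A, eulerOperator b σ h φ (U ω) ∂P := by
  have hA' : MeasurableSet A := F.le s _ hA
  have hst : s ≤ s + h := le_self_add
  have hξ := hB.measurable_increment s (s + h)
  have h1A : Measurable[F s] (A.indicator fun _ => (1 : ℝ≥0∞)) := measurable_const.indicator hA
  have hV : Measurable[F s] fun ω => (A.indicator (fun _ => (1 : ℝ≥0∞)) ω, U ω) := h1A.prodMk hU
  have hV' : Measurable fun ω => (A.indicator (fun _ => (1 : ℝ≥0∞)) ω, U ω) :=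
    hV.mono (F.le s) le_rfl
  have hind := (indepFun_iff_map_prod_eq_prod_map_map hV'.aemeasurable hξ.aemeasurable).1
    (hB.indepFun_increment hst hV)
  have hΨ : Measurable fun q : (ℝ≥0∞ × EuclideanSpace ℝ (Fin d)) × EuclideanSpace ℝ (Fin k) =>
      q.1.1 * φ (eulerStep b σ h q.1.2 q.2) :=
    (measurable_fst.comp measurable_fst).mul (hφ.comp (measurable_eulerStep b σ hb hσ h
      (measurable_snd.comp measurable_fst) measurable_snd))
  have hind1 : ∀ g : Ω → ℝ≥0∞, ∫⁻ ω in A, g ω ∂P =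
      ∫⁻ ω, A.indicator (fun _ => (1 : ℝ≥0∞)) ω * g ω ∂P := fun g => by
    rw [← lintegral_indicator hA']
    refine lintegral_congr fun ω => ?_
    by_cases hω : ω ∈ A <;> simp [hω]
  have hsqrt : Real.sqrt (((s + h : ℝ≥0) : ℝ) - s) = Real.sqrt h := by
    congr 1
    push_cast
    ring
  rw [hind1, hind1, ← lintegral_map (f := fun q : (ℝ≥0∞ × EuclideanSpace ℝ (Fin d)) ×
    EuclideanSpace ℝ (Fin k) => q.1.1 * φ (eulerStep b σ h q.1.2 q.2)) hΨ (hV'.prodMk hξ), hind,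
    lintegral_prod _ hΨ.aemeasurable, lintegral_map hΨ.lintegral_prod_right' hV']
  refine lintegral_congr fun ω => ?_
  have hstep : Measurable fun z => φ (eulerStep b σ h (U ω) z) :=
    hφ.comp (measurable_eulerStep b σ hb hσ h measurable_const measurable_id)
  rw [lintegral_const_mul _ hstep, hB.increment_law s (s + h) hst, hsqrt,
    lintegral_map hstep (by fun_prop), eulerOperator]

/-- The last step is integrated out first, replacing `φ` by its image under the operator; hence the
induction is over all `φ`. -/
theorem IsBrownianMotion.setLIntegral_euler (hB : IsBrownianMotion P F B)
    (hb : Measurable b) (hσ : Measurable σ) (h : ℝ≥0) {u : ℕ → ℝ≥0}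
    (hu : ∀ i, u (i + 1) = u i + h) {Y : Ω → EuclideanSpace ℝ (Fin d)}
    (hY : Measurable[F (u 0)] Y) {A : Set Ω} (hA : MeasurableSet[F (u 0)] A) (n : ℕ)
    {φ : EuclideanSpace ℝ (Fin d) → ℝ≥0∞} (hφ : Measurable φ) :
    ∫⁻ ω in A, φ (euler b σ h Y (fun i => B (u i)) n ω) ∂P =
      ∫⁻ ω in A, (eulerOperator b σ h)^[n] φ (Y ω) ∂P := by
  have hmono : Monotone u := monotone_nat_of_le_succ fun i => by rw [hu]; exact le_self_add
  induction n generalizing φ with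
  | zero => rfl
  | succ n ih =>
    rw [Function.iterate_succ_apply, ← ih (measurable_eulerOperator hb hσ h hφ),
      ← hB.setLIntegral_eulerStep hb hσ (u n) h hφ
        (measurable_euler (𝒢 := fun i => F (u i)) b σ (fun i j hij => F.mono (hmono hij)) hb hσ h hY
          (fun i => hB.adapted _) n) (F.mono (hmono (Nat.zero_le n)) _ hA), ← hu]
    rfl

-- On the degenerate interval `[0, 0]` the Riemann sums are empty, and uniqueness of limits in
-- measure forces `I 0 = 0` almost surely.
omit [IsProbabilityMeasure P] in
theorem IsSDESolution.ae_start {x : EuclideanSpace ℝ (Fin d)}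
    {X : ℝ≥0 → Ω → EuclideanSpace ℝ (Fin d)} (hX : IsSDESolution P F B b σ x X) :
    ∀ᵐ ω ∂P, X 0 ω = x := by
  obtain ⟨I, hI, heq⟩ := hX.equation
  have h := hI 0 (fun _ => 0) (fun _ _ => 0) (fun _ => ⟨monotone_const, rfl, rfl⟩)
    (fun ε _ => Eventually.of_forall fun _ i hi => absurd hi (Nat.not_lt_zero i))
  have h0 : TendstoInMeasure P (fun (_ : ℕ) (_ : Ω) => (0 : EuclideanSpace ℝ (Fin d))) atTop
      (fun _ => 0) := fun ε hε => by simp [hε.ne']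
  have hI0 := tendstoInMeasure_ae_unique h (by simpa using h0)
  filter_upwards [heq 0, hI0] with ω h1 h2
  rw [h1, h2]
  simp

/-- Almost Markov property: the conditional expectation of a test function at time `(p + 1) * t` is
asymptotically given by the Euler transition operators applied at time `p * t`. -/
theorem IsSDESolution.eventually_lintegral_eulerOperator (hB : IsBrownianMotion P F B)
    (hb : LocallyLipschitz b) (hσ : LocallyLipschitz σ) {x : EuclideanSpace ℝ (Fin d)}
    {X : ℝ≥0 → Ω → EuclideanSpace ℝ (Fin d)} (hX : IsSDESolution P F B b σ x X) (t : ℝ≥0)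
    (p : ℕ) {φ : EuclideanSpace ℝ (Fin d) → ℝ≥0∞} (hφm : Measurable φ)
    (hφ : ∀ y z, φ y ≤ φ z + ENNReal.ofReal (cutNorm (y - z))) {η : ℝ≥0} (hη : 0 < η)
    {A : Set Ω} (hA : MeasurableSet[F (p * t)] A) :
    ∀ᶠ R : ℕ in atTop, ∀ᶠ n : ℕ in atTop,
      ∫⁻ ω in A, φ (X ((p + 1 : ℕ) * t) ω) ∂P ≤
        ∫⁻ ω in A, (eulerOperator (truncated R b) (truncated R σ) (t / n))^[n] φ
          (X (p * t) ω) ∂P + η ∧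
      ∫⁻ ω in A, (eulerOperator (truncated R b) (truncated R σ) (t / n))^[n] φ
          (X (p * t) ω) ∂P ≤ ∫⁻ ω in A, φ (X ((p + 1 : ℕ) * t) ω) ∂P + η := by
  have hXm : ∀ s, Measurable (X s) := fun s => (hX.adapted s).mono (F.le s) le_rfl
  have hBm : ∀ s, Measurable (B s) := fun s => (hB.adapted s).mono (F.le s) le_rfl
  have hη' : (0 : ℝ) < η := by exact_mod_cast hη
  filter_upwards [hX.eventually_integral_cutNorm_sub_euler_le hB hb hσ t p hη'] with R hR
  filter_upwards [hR, eventually_gt_atTop 0] with n hn hn0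
  have hbm := measurable_truncated hb.continuous (R : ℝ)
  have hσm := measurable_truncated hσ.continuous (R : ℝ)
  have hn' : (n : ℝ≥0) ≠ 0 := by exact_mod_cast hn0.ne'
  have hstart : ((p * n + 0 : ℕ) : ℝ≥0) * (t / n) = p * t := by
    push_cast
    field_simp
    simp
  rw [← hB.setLIntegral_euler hbm hσm (t / n) (u := fun i => (p * n + i : ℕ) * (t / n))
    (fun i => by push_cast; ring) (by rw [hstart]; exact hX.adapted _) (by rwa [hstart]) n hφm]
  set E := euler (truncated R b) (truncated R σ) ((t / n : ℝ≥0) : ℝ) (X (p * t))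
    (fun i => B ((p * n + i : ℕ) * (t / n))) n with hE
  have hEm : Measurable E := measurable_euler (𝒢 := fun _ => mΩ) _ _ (fun _ _ _ => le_rfl)
    hbm hσm _ (hXm _) (fun _ => hBm _) _
  have hcm : Measurable fun ω => cutNorm (X ((p + 1 : ℕ) * t) ω - E ω) :=
    continuous_cutNorm.measurable.comp ((hXm _).sub hEm)
  have hI : Integrable (fun ω => cutNorm (X ((p + 1 : ℕ) * t) ω - E ω)) P :=
    Integrable.of_bound hcm.aestronglyMeasurable 1 (ae_of_all _ fun ω => by
      rw [Real.norm_of_nonneg (cutNorm_nonneg _)]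
      exact cutNorm_le_one _)
  have herr : ∫⁻ ω in A, ENNReal.ofReal (cutNorm (X ((p + 1 : ℕ) * t) ω - E ω)) ∂P ≤ η := by
    refine (setLIntegral_le_lintegral _ _).trans ?_
    rw [← ofReal_integral_eq_lintegral_ofReal hI (ae_of_all _ fun ω => cutNorm_nonneg _)]
    exact (ENNReal.ofReal_le_ofReal hn).trans_eq (ENNReal.ofReal_coe_nnreal)
  have key : ∀ V W : Ω → EuclideanSpace ℝ (Fin d), Measurable W →
      (∀ ω, cutNorm (V ω - W ω) = cutNorm (X ((p + 1 : ℕ) * t) ω - E ω)) →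
      ∫⁻ ω in A, φ (V ω) ∂P ≤ ∫⁻ ω in A, φ (W ω) ∂P + η := fun V W hW hVW => by
    calc ∫⁻ ω in A, φ (V ω) ∂P
        ≤ ∫⁻ ω in A, (φ (W ω) + ENNReal.ofReal (cutNorm (X ((p + 1 : ℕ) * t) ω - E ω))) ∂P :=
          lintegral_mono fun ω => by rw [← hVW]; exact hφ _ _
      _ = ∫⁻ ω in A, φ (W ω) ∂P +
          ∫⁻ ω in A, ENNReal.ofReal (cutNorm (X ((p + 1 : ℕ) * t) ω - E ω)) ∂P :=
          lintegral_add_left (hφm.comp hW) _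
      _ ≤ _ := by gcongr
  exact ⟨key _ _ hEm fun ω => rfl, key _ _ (hXm _) fun ω => by rw [← cutNorm_neg, neg_sub]⟩

/-- A lower bound for the transition probabilities, uniform over a ball, propagates to later times
by the Markov property. -/
theorem IsSDESolution.mul_measure_le_setLIntegral (hB : IsBrownianMotion P F B)
    (hb : LocallyLipschitz b) (hσ : LocallyLipschitz σ)
    {X : EuclideanSpace ℝ (Fin d) → ℝ≥0 → Ω → EuclideanSpace ℝ (Fin d)}
    (hX : ∀ x, IsSDESolution P F B b σ x (X x)) (t : ℝ≥0)
    {φ : EuclideanSpace ℝ (Fin d) → ℝ≥0∞} (hφm : Measurable φ)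
    (hφ : ∀ y z, φ y ≤ φ z + ENNReal.ofReal (cutNorm (y - z))) {ρ : ℝ} {ε : ℝ≥0∞}
    (hε : ∀ y, ‖y‖ ≤ ρ → ε ≤ ∫⁻ ω, φ (X y t ω) ∂P) (x : EuclideanSpace ℝ (Fin d)) (p : ℕ)
    {A : Set Ω} (hA : MeasurableSet[F (p * t)] A) (hAρ : ∀ ω ∈ A, ‖X x (p * t) ω‖ ≤ ρ) :
    ε * P A ≤ ∫⁻ ω in A, φ (X x ((p + 1 : ℕ) * t) ω) ∂P := by
  have hXm : ∀ s, Measurable (X x s) := fun s => ((hX x).adapted s).mono (F.le s) le_rfl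
  have hA' : MeasurableSet A := F.le _ _ hA
  set g : ℕ → ℕ → EuclideanSpace ℝ (Fin d) → ℝ≥0∞ := fun R n =>
    (eulerOperator (truncated R b) (truncated R σ) (t / n))^[n] φ with hg
  have hgm : ∀ R n, Measurable (g R n) := fun R n => measurable_eulerOperator_iterate
    (measurable_truncated hb.continuous _) (measurable_truncated hσ.continuous _) _ hφm _
  -- The approximation is used at `p = 0` with the deterministic start `y`. How large `R` and `n`
  -- must be depends on `y`, so the bound is recorded as an iterated liminf.
  have hlow : ∀ y, ‖y‖ ≤ ρ →
      ε ≤ liminf (fun R => liminf (fun n => g R n y) atTop) atTop := by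
    intro y hy
    refine ENNReal.le_of_forall_pos_le_add fun η hη _ => tsub_le_iff_right.1 ?_
    have h := (hX y).eventually_lintegral_eulerOperator hB hb hσ t 0 hφm hφ hη
      (A := Set.univ) MeasurableSet.univ
    refine le_liminf_of_le (by isBoundedDefault) ?_
    filter_upwards [h] with R hR
    refine le_liminf_of_le (by isBoundedDefault) ?_
    filter_upwards [hR] with n hn
    have h1 := hn.1
    have h2 : ∫⁻ ω, g R n (X y 0 ω) ∂P = g R n y := by
      rw [lintegral_congr_ae ((hX y).ae_start.mono fun ω hω => by rw [hω])]
      simp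
    simp only [Measure.restrict_univ, zero_add, Nat.cast_one, one_mul, Nat.cast_zero,
      zero_mul] at h1
    rw [tsub_le_iff_right, ← h2]
    exact (hε y hy).trans h1
  refine ENNReal.le_of_forall_pos_le_add fun η hη _ => ?_
  -- Fatou's lemma in `R`, then in `n`, replaces the missing uniformity in the starting point; the
  -- approximation along the path from `x`, in the opposite direction, closes the chain.
  calc ε * P A = ∫⁻ ω in A, ε ∂P := by rw [setLIntegral_const]
    _ ≤ ∫⁻ ω in A, liminf (fun R => liminf (fun n => g R n (X x (p * t) ω)) atTop) atTop ∂P :=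
        setLIntegral_mono' hA' fun ω hω => hlow _ (hAρ ω hω)
    _ ≤ liminf (fun R => ∫⁻ ω in A, liminf (fun n => g R n (X x (p * t) ω)) atTop ∂P) atTop :=
        lintegral_liminf_le fun R => .liminf fun n => (hgm R n).comp (hXm _)
    _ ≤ liminf (fun R => liminf (fun n => ∫⁻ ω in A, g R n (X x (p * t) ω) ∂P) atTop) atTop :=
        liminf_le_liminf (Eventually.of_forall fun R =>
          lintegral_liminf_le fun n => (hgm R n).comp (hXm _))
    _ ≤ ∫⁻ ω in A, φ (X x ((p + 1 : ℕ) * t) ω) ∂P + η := by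
        refine liminf_le_of_frequently_le' (Eventually.frequently ?_)
        filter_upwards [(hX x).eventually_lintegral_eulerOperator hB hb hσ t p hφm hφ hη hA]
          with R hR
        refine liminf_le_of_frequently_le' (Eventually.frequently ?_)
        filter_upwards [hR] with n hn
        exact hn.2

end Markov

/-! ### From the Markov bound to the mean exit time. -/

section ExitTime

/-- The Lipschitz function which vanishes on the ball of radius `r` and equals one outside the ball
of radius `r + 1`. -/
noncomputable def ramp {V : Type*} [NormedAddCommGroup V] (r : ℝ) (y : V) : ℝ≥0∞ :=
  ENNReal.ofReal (min 1 (‖y‖ - r))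

theorem measurable_ramp {V : Type*} [NormedAddCommGroup V] [MeasurableSpace V] [BorelSpace V]
    (r : ℝ) : Measurable (ramp r : V → ℝ≥0∞) := by
  unfold ramp
  fun_prop

/-- This is the modulus of continuity demanded of test functions in the Euler approximation; a
merely continuous `f` need not have it. -/
theorem ramp_le_add {V : Type*} [NormedAddCommGroup V] (r : ℝ) (y z : V) :
    ramp r y ≤ ramp r z + ENNReal.ofReal (cutNorm (y - z)) := by
  by_cases h : min 1 (‖y‖ - r) ≤ 0
  · simp [ramp, ENNReal.ofReal_of_nonpos h]
  have h' := not_le.1 h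
  unfold ramp
  rcases le_total (‖z‖ - r) 0 with hz | hz
  · refine le_add_left (ENNReal.ofReal_le_ofReal (min_le_min le_rfl ?_))
    linarith [norm_sub_norm_le y z]
  · rw [← ENNReal.ofReal_add (le_min zero_le_one hz) (cutNorm_nonneg _)]
    refine ENNReal.ofReal_le_ofReal ?_
    have h1 := norm_sub_norm_le y z
    have h2 := norm_nonneg (y - z)
    unfold cutNorm
    rcases le_total 1 (‖z‖ - r) with h3 | h3
    · rw [min_eq_left h3]
      linarith [min_le_left 1 (‖y‖ - r), le_min zero_le_one h2]
    · rw [min_eq_right h3]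
      rcases le_total 1 ‖y - z‖ with h4 | h4
      · rw [min_eq_left h4]
        linarith [min_le_left 1 (‖y‖ - r)]
      · rw [min_eq_right h4]
        linarith [min_le_right 1 (‖y‖ - r)]

variable {Ω : Type*} {d : ℕ}

/-- The event that `X` lies in the closed ball of radius `ρ` at the times `0, t, …, n * t`. -/
def stayEvent (X : ℝ≥0 → Ω → EuclideanSpace ℝ (Fin d)) (t : ℝ≥0) (ρ : ℝ) (n : ℕ) : Set Ω :=
  ⋂ (j : ℕ) (_ : j ≤ n), {ω | ‖X (j * t) ω‖ ≤ ρ}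

/-- If `N` is the first index whose stay event fails, the sum has `N` terms equal to `t` and the
path is outside by time `N * t`. If none fails, the sum is infinite because `t ≠ 0`. -/
theorem exitTime_le_tsum (X : ℝ≥0 → Ω → EuclideanSpace ℝ (Fin d)) {t : ℝ≥0} (ht : t ≠ 0) (ρ : ℝ)
    (ω : Ω) :
    exitTime X ρ ω ≤ ∑' n, (stayEvent X t ρ n).indicator (fun _ => (t : ℝ≥0∞)) ω := by
  classical
  by_cases hex : ∃ n, ω ∉ stayEvent X t ρ n
  · set N := Nat.find hex with hN
    have hout : ω ∉ stayEvent X t ρ N := Nat.find_spec hex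
    simp only [stayEvent, Set.mem_iInter, not_forall] at hout
    obtain ⟨j, hj, hjω⟩ := hout
    have hjω' : ¬‖X (j * t) ω‖ ≤ ρ := hjω
    have hle : exitTime X ρ ω ≤ ((j * t : ℝ≥0) : ℝ≥0∞) :=
      iInf₂_le (j * t : ℝ≥0) (not_le.1 hjω').le
    calc exitTime X ρ ω ≤ ((j * t : ℝ≥0) : ℝ≥0∞) := hle
      _ ≤ ((N * t : ℝ≥0) : ℝ≥0∞) := by gcongr
      _ = ∑ n ∈ Finset.range N, (stayEvent X t ρ n).indicator (fun _ => (t : ℝ≥0∞)) ω := by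
        rw [Finset.sum_congr rfl (g := fun _ => (t : ℝ≥0∞)) fun n hn =>
          Set.indicator_of_mem (not_not.1 (Nat.find_min hex (Finset.mem_range.1 hn))) _]
        simp [hN]
      _ ≤ _ := ENNReal.sum_le_tsum _
  · push Not at hex
    have hall : ∀ n, (stayEvent X t ρ n).indicator (fun _ => (t : ℝ≥0∞)) ω = t := fun n =>
      Set.indicator_of_mem (hex n) _
    simp only [hall]
    rw [ENNReal.tsum_const_eq_top_of_ne_zero (by exact_mod_cast ht)]
    exact le_top

theorem measurableSet_stayEvent {mΩ : MeasurableSpace Ω} {F : Filtration ℝ≥0 mΩ}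
    {X : ℝ≥0 → Ω → EuclideanSpace ℝ (Fin d)} (hX : Adapted F X) (t : ℝ≥0) (ρ : ℝ) (n : ℕ) :
    MeasurableSet[F (n * t)] (stayEvent X t ρ n) := by
  refine .iInter fun j => .iInter fun hj => ?_
  have h1 : Measurable[F (n * t)] (X (j * t)) := (hX _).mono (F.mono (by gcongr)) le_rfl
  exact h1 (isClosed_le continuous_norm continuous_const).measurableSet

/-- If the process leaves the ball with conditional probability at least `ε` in each time interval
of length `t`, then the expected exit time is at most `t / ε`. -/
theorem lintegral_exitTime_le [mΩ : MeasurableSpace Ω] {P : Measure Ω} [IsProbabilityMeasure P]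
    {F : Filtration ℝ≥0 mΩ} {X : ℝ≥0 → Ω → EuclideanSpace ℝ (Fin d)} (hX : Adapted F X)
    {t : ℝ≥0} (ht : t ≠ 0) {ρ : ℝ} {ε : ℝ≥0∞}
    (h : ∀ n, ε * P (stayEvent X t ρ n) ≤
      ∫⁻ ω in stayEvent X t ρ n, ramp ρ (X ((n + 1 : ℕ) * t) ω) ∂P) :
    ∫⁻ ω, exitTime X ρ ω ∂P ≤ t * ε⁻¹ := by
  have hA : ∀ n, MeasurableSet (stayEvent X t ρ n) := fun n =>
    F.le _ _ (measurableSet_stayEvent hX t ρ n)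
  have hstep : ∀ n, ε * P (stayEvent X t ρ n) + P (stayEvent X t ρ (n + 1)) ≤
      P (stayEvent X t ρ n) := by
    intro n
    have hsub : stayEvent X t ρ (n + 1) ⊆ stayEvent X t ρ n :=
      Set.biInter_subset_biInter_left fun j (hj : j ≤ n) => hj.trans n.le_succ
    -- The ramp is at most 1 and vanishes if the path is back in the ball at the next time.
    have hint : ∫⁻ ω in stayEvent X t ρ n, ramp ρ (X ((n + 1 : ℕ) * t) ω) ∂P ≤
        P (stayEvent X t ρ n \ stayEvent X t ρ (n + 1)) := by
      rw [← lintegral_indicator_one ((hA n).diff (hA (n + 1))), ← lintegral_indicator (hA n)]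
      refine lintegral_mono fun ω => ?_
      by_cases hω : ω ∈ stayEvent X t ρ n
      · rw [Set.indicator_of_mem hω]
        by_cases hω' : ω ∈ stayEvent X t ρ (n + 1)
        · have hle : ‖X ((n + 1 : ℕ) * t) ω‖ ≤ ρ := Set.mem_iInter₂.1 hω' (n + 1) le_rfl
          have hzero : ramp ρ (X ((n + 1 : ℕ) * t) ω) = 0 :=
            ENNReal.ofReal_of_nonpos ((min_le_right _ _).trans (by linarith))
          rw [hzero]
          exact zero_le
        · rw [Set.indicator_of_mem (show ω ∈ _ \ _ from ⟨hω, hω'⟩)]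
          exact ENNReal.ofReal_le_one.2 (min_le_left _ _)
      · rw [Set.indicator_of_notMem hω]
        exact zero_le
    calc _ ≤ P (stayEvent X t ρ n \ stayEvent X t ρ (n + 1)) + P (stayEvent X t ρ (n + 1)) := by
          gcongr
          exact (h n).trans hint
      _ = P (stayEvent X t ρ n) := by
          rw [← measure_inter_add_sdiff (stayEvent X t ρ n) (hA (n + 1)),
            Set.inter_eq_self_of_subset_right hsub, add_comm]
  have hsum : ∀ N, ε * ∑ n ∈ Finset.range N, P (stayEvent X t ρ n) + P (stayEvent X t ρ N) ≤ 1 := by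
    intro N
    induction N with
    | zero => simpa using prob_le_one
    | succ N ih =>
      refine le_trans ?_ ih
      rw [Finset.sum_range_succ, mul_add, add_assoc]
      gcongr
      exact hstep N
  have htsum : ∑' n, P (stayEvent X t ρ n) ≤ ε⁻¹ := by
    refine ENNReal.tsum_le_of_sum_range_le fun N => ?_
    rw [ENNReal.le_inv_iff_mul_le, mul_comm]
    exact le_self_add.trans (hsum N)
  calc ∫⁻ ω, exitTime X ρ ω ∂P
      ≤ ∫⁻ ω, ∑' n, (stayEvent X t ρ n).indicator (fun _ => (t : ℝ≥0∞)) ω ∂P :=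
        lintegral_mono fun ω => exitTime_le_tsum X ht ρ ω
    _ = ∑' n, t * P (stayEvent X t ρ n) := by
        rw [lintegral_tsum fun n => (measurable_const.indicator (hA n)).aemeasurable]
        simp only [lintegral_indicator_const (hA _)]
    _ ≤ t * ε⁻¹ := by
        rw [ENNReal.tsum_mul_left]
        gcongr

end ExitTime

/-! ### The main theorem. -/

theorem proposition3 {Ω : Type*} [mΩ : MeasurableSpace Ω] (P : Measure Ω) [IsProbabilityMeasure P]
    (F : Filtration ℝ≥0 mΩ) (k d : ℕ)
    (B : ℝ≥0 → Ω → EuclideanSpace ℝ (Fin k)) (hB : IsBrownianMotion P F B)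
    (b : EuclideanSpace ℝ (Fin d) → EuclideanSpace ℝ (Fin d)) (hb : LocallyLipschitz b)
    (σ : EuclideanSpace ℝ (Fin d) →
      (EuclideanSpace ℝ (Fin k) →L[ℝ] EuclideanSpace ℝ (Fin d)))
    (hσ : LocallyLipschitz σ)
    (hσ_bdd : ∃ C : ℝ, ∀ x, ‖σ x ∘L (σ x).adjoint‖ ≤ C)
    (X : EuclideanSpace ℝ (Fin d) → ℝ≥0 → Ω → EuclideanSpace ℝ (Fin d))
    (hX : ∀ x, IsSDESolution P F B b σ x (X x))
    (h : ∀ R : ℝ, 0 < R →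
      ∃ f : EuclideanSpace ℝ (Fin d) → ℝ,
        Continuous f ∧ (∀ y, f y ∈ Set.Icc (0 : ℝ) 1) ∧
        tsupport f ⊆ {y | R + 1 ≤ ‖y‖} ∧
        ∃ t₀ : ℝ≥0,
          0 < ⨅ x : {x : EuclideanSpace ℝ (Fin d) // ‖x‖ ≤ R}, ∫ ω, f (X x t₀ ω) ∂P) :
    ConditionAT P X := by
  intro R hR
  -- Radius `R + 1`, not `R`: the Markov step restarts from any point of the ball to be left. Then
  -- `f` vanishes where `‖y‖ < R + 2`, so it lies below `ramp (R + 1)`.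
  obtain ⟨f, hfc, hf01, hfsupp, t₀, hpos⟩ := h (R + 1) (by linarith)
  set ε := ⨅ x : {x : EuclideanSpace ℝ (Fin d) // ‖x‖ ≤ R + 1}, ∫ ω, f (X x t₀ ω) ∂P with hε
  have hle : ∀ y : EuclideanSpace ℝ (Fin d), ‖y‖ ≤ R + 1 → ε ≤ ∫ ω, f (X y t₀ ω) ∂P :=
    fun y hy => ciInf_le (f := fun x : {x : EuclideanSpace ℝ (Fin d) // ‖x‖ ≤ R + 1} =>
      ∫ ω, f (X x t₀ ω) ∂P) ⟨0, by
        rintro _ ⟨x, rfl⟩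
        exact integral_nonneg fun ω => (hf01 _).1⟩ ⟨y, hy⟩
  have hf0 : ∀ y, ‖y‖ < R + 1 + 1 → f y = 0 := fun y hy => by
    by_contra hne
    exact absurd (hfsupp (subset_tsupport f hne)) (not_le.2 hy)
  -- At time 0 the process from the origin sits where `f` vanishes, contradicting positivity of the
  -- infimum.
  have ht₀ : t₀ ≠ 0 := by
    rintro rfl
    have h0 := hle 0 (by simpa using by linarith)
    have hz : ∫ ω, f (X 0 0 ω) ∂P = 0 := by
      rw [integral_congr_ae (g := fun _ => (0 : ℝ)) ((hX 0).ae_start.mono fun ω hω => by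
        change f (X 0 0 ω) = 0
        rw [hω, hf0 0 (by simpa using by linarith)])]
      simp
    linarith
  have hramp : ∀ y, ENNReal.ofReal (f y) ≤ ramp (R + 1) y := fun y => by
    by_cases hy : ‖y‖ < R + 1 + 1
    · simp [hf0 y hy]
    · refine ENNReal.ofReal_le_ofReal (le_min (hf01 y).2 ?_)
      linarith [(hf01 y).2, not_lt.1 hy]
  have hlow : ∀ y : EuclideanSpace ℝ (Fin d), ‖y‖ ≤ R + 1 →
      ENNReal.ofReal ε ≤ ∫⁻ ω, ramp (R + 1) (X y t₀ ω) ∂P := fun y hy => by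
    have hm : Measurable fun ω => f (X y t₀ ω) :=
      hfc.measurable.comp (((hX y).adapted t₀).mono (F.le t₀) le_rfl)
    have hI : Integrable (fun ω => f (X y t₀ ω)) P :=
      Integrable.of_bound hm.aestronglyMeasurable 1 (ae_of_all _ fun ω => by
        rw [Real.norm_of_nonneg (hf01 _).1]
        exact (hf01 _).2)
    refine (ENNReal.ofReal_le_ofReal (hle y hy)).trans ?_
    rw [ofReal_integral_eq_lintegral_ofReal hI (ae_of_all _ fun ω => (hf01 _).1)]
    exact lintegral_mono fun ω => hramp _
  have hbound : ∀ x : EuclideanSpace ℝ (Fin d),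
      ∫⁻ ω, exitTime (X x) (R + 1) ω ∂P ≤ t₀ * (ENNReal.ofReal ε)⁻¹ := fun x =>
    lintegral_exitTime_le (hX x).adapted ht₀ fun n =>
      IsSDESolution.mul_measure_le_setLIntegral hB hb hσ hX t₀ (measurable_ramp _) (ramp_le_add _)
        hlow x n (measurableSet_stayEvent (hX x).adapted t₀ (R + 1) n)
        fun ω hω => Set.mem_iInter₂.1 hω n le_rfl
  refine lt_of_le_of_lt (iSup₂_le fun x _ => hbound x) ?_
  exact ENNReal.mul_lt_top ENNReal.coe_lt_top (ENNReal.inv_lt_top.2 (ENNReal.ofReal_pos.2 hpos))
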